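/- Let $E$ be a complex Banach space, let $(T(it))_{t\in\mathbb R}$ be a $C_0$-group of bounded operators on $E$, and let $A$ be the operator in $E$ such that $iA$ is the generator of this group. Suppose that, for some $\delta>0$, the spectrum of $A$ splits as $\sigma(A)=\sigma_1\cup\sigma_2$ with $\sigma_1\subset\{z\in\mathbb C:\operatorname{Re}z<-\delta\}$ and $\sigma_2\subset\{z\in\mathbb C:\operatorname{Re}z>\delta\}$. Then there exist two closed subspaces $E_1,E_2$ of $E$, each invariant under $T(it)$ for all $t\in\mathbb R$, with $E_1\cap E_2=\{0\}$, such that: (i) $D(A)\subset E_1\oplus E_2$ (the direct sum is algebraic and need not be closed); (ii) $A_1:=A|_{E_1}$ generates a holomorphic semigroup of angle $\pi/2$ on $E_1$, and $\sigma(A_1)=\sigma_1$; (iii) $-A_2:=-A|_{E_2}$ generates a holomorphic semigroup of angle $\pi/2$ on $E_2$, and $\sigma(A_2)=\sigma_2$. Here $A|_{E_k}$ is the operator in $E_k$ with domain $\{x\in D(A)\cap E_k: Ax\in E_k\}$ acting as $A$. For $0<\theta\le\pi$ put $\Sigma_\theta=\{z\in\mathbb C\setminus\{0\}:|\arg z|<\theta\}$.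 An operator $B$ generates a bounded holomorphic semigroup of angle $\theta\in(0,\pi/2]$ if it generates a $C_0$-semigroup that has a holomorphic extension to $\Sigma_\theta$ which is bounded on $\Sigma_{\theta'}$ for each $0<\theta'<\theta$; and $B$ generates a holomorphic semigroup of angle $\phi\in(0,\pi/2]$ if for every $\theta\in(0,\phi)$ there is $\omega\ge0$ such that $B-\omega I$ generates a bounded holomorphic semigroup of angle $\theta$. -/

import Mathlib

open Filter Topology Set

namespace SplittingGroup

variable {E : Type*} [NormedAddCommGroup E] [NormedSpace ℂ E]

/-- A `C₀`-semigroup `(T(t))_{t ≥ 0}` of bounded linear operators on `E`.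
The values of `T` at negative times are irrelevant. -/
structure IsC0Semigroup (T : ℝ → E →L[ℂ] E) : Prop where
  map_zero : T 0 = ContinuousLinearMap.id ℂ E
  map_add : ∀ s t : ℝ, 0 ≤ s → 0 ≤ t → T (s + t) = (T s).comp (T t)
  strong_cont : ∀ x : E, ContinuousOn (fun t : ℝ => T t x) (Ici 0)

/-- A `C₀`-group `(U(t))_{t ∈ ℝ}` of bounded linear operators on `E`. -/
structure IsC0Group (U : ℝ → E →L[ℂ] E) : Prop where
  map_zero : U 0 = ContinuousLinearMap.id ℂ E
  map_add : ∀ s t : ℝ, U (s + t) = (U s).comp (U t)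
  strong_cont : ∀ x : E, Continuous (fun t : ℝ => U t x)

/-- The (possibly unbounded) operator `A` is the infinitesimal generator of the semigroup `T`:
`x ∈ D(A)` with `A x = y` if and only if `(T(h) x - x) / h → y` as `h → 0+`. -/
def IsSemigroupGenerator (T : ℝ → E →L[ℂ] E) (A : E →ₗ.[ℂ] E) : Prop :=
  ∀ x y : E, (x, y) ∈ A.graph ↔
    Tendsto (fun h : ℝ => (h : ℂ)⁻¹ • (T h x - x)) (𝓝[>] 0) (𝓝 y)

/-- The (possibly unbounded) operator `B` is the infinitesimal generator of the group `U`: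
`x ∈ D(B)` with `B x = y` if and only if `(U(h) x - x) / h → y` as `h → 0`. -/
def IsGroupGenerator (U : ℝ → E →L[ℂ] E) (B : E →ₗ.[ℂ] E) : Prop :=
  ∀ x y : E, (x, y) ∈ B.graph ↔
    Tendsto (fun h : ℝ => (h : ℂ)⁻¹ • (U h x - x)) (𝓝[≠] 0) (𝓝 y)

/-- The open sector `Σ_φ = {z ≠ 0 : |arg z| < φ}`. -/
def sector (φ : ℝ) : Set ℂ := {z : ℂ | z ≠ 0 ∧ |z.arg| < φ}

/-- `A` generates a bounded holomorphic semigroup of angle `φ`: it generates a `C₀`-semigroup which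
has a holomorphic extension to `Σ_φ` that is bounded on each smaller sector. -/
def GeneratesBoundedHolomorphic (A : E →ₗ.[ℂ] E) (φ : ℝ) : Prop :=
  ∃ T : ℝ → E →L[ℂ] E, IsC0Semigroup T ∧ IsSemigroupGenerator T A ∧
    ∃ S : ℂ → E →L[ℂ] E, (∀ t : ℝ, 0 < t → S (t : ℂ) = T t) ∧
      DifferentiableOn ℂ S (sector φ) ∧
      ∀ φ' : ℝ, 0 < φ' → φ' < φ → ∃ M : ℝ, ∀ z ∈ sector φ', ‖S z‖ ≤ M

/-- The operator `A - ω I` with domain `D(A)`. -/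
noncomputable def shift (A : E →ₗ.[ℂ] E) (ω : ℝ) : E →ₗ.[ℂ] E :=
  (-((ω : ℂ) • (LinearMap.id : E →ₗ[ℂ] E))) +ᵥ A

/-- `A` generates a holomorphic semigroup of angle `φ`: for every `θ ∈ (0, φ)` there is `ω ≥ 0`
such that `A - ω I` generates a bounded holomorphic semigroup of angle `θ`. -/
def GeneratesHolomorphic (A : E →ₗ.[ℂ] E) (φ : ℝ) : Prop :=
  ∀ θ : ℝ, 0 < θ → θ < φ → ∃ ω : ℝ, 0 ≤ ω ∧ GeneratesBoundedHolomorphic (shift A ω) θ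

/-- The resolvent set `ρ(A)`: all `μ` for which `μ - A : D(A) → E` has a bounded
everywhere defined two-sided inverse `R`. -/
def resolventSet (A : E →ₗ.[ℂ] E) : Set ℂ :=
  {μ : ℂ | ∃ R : E →L[ℂ] E,
    (∀ x : A.domain, R (μ • (x : E) - A x) = x) ∧
    ∀ y : E, ∃ h : R y ∈ A.domain, μ • R y - A ⟨R y, h⟩ = y}

/-- The spectrum `σ(A)`, the complement of the resolvent set. -/
def spectrum (A : E →ₗ.[ℂ] E) : Set ℂ := (resolventSet A)ᶜ

/-- The restriction `A|_F` of `A` to a subspace `F`, as an operator in `F`, with domain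
`{x ∈ D(A) ∩ F : A x ∈ F}`. -/
def restrict (A : E →ₗ.[ℂ] E) (F : Submodule ℂ E) : F →ₗ.[ℂ] F where
  domain :=
    { carrier := {x : F | ∃ h : (x : E) ∈ A.domain, A ⟨x, h⟩ ∈ F}
      zero_mem' := ⟨A.domain.zero_mem, by
        have h0 : A ⟨((0 : F) : E), A.domain.zero_mem⟩ = 0 := A.map_zero
        rw [h0]; exact F.zero_mem⟩
      add_mem' := by
        rintro x y ⟨hx, hx'⟩ ⟨hy, hy'⟩
        refine ⟨A.domain.add_mem hx hy, ?_⟩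
        have h := A.map_add ⟨x, hx⟩ ⟨y, hy⟩
        exact h ▸ F.add_mem hx' hy'
      smul_mem' := by
        rintro c x ⟨hx, hx'⟩
        refine ⟨A.domain.smul_mem c hx, ?_⟩
        have h := A.map_smul c ⟨x, hx⟩
        exact h ▸ F.smul_mem c hx' }
  toFun :=
    { toFun := fun x => ⟨A ⟨((x : F) : E), x.2.1⟩, x.2.2⟩
      map_add' := fun x y =>
        Subtype.ext (A.map_add ⟨((x : F) : E), x.2.1⟩ ⟨((y : F) : E), y.2.1⟩)
      map_smul' := fun c x =>
        Subtype.ext (A.map_smul c ⟨((x : F) : E), x.2.1⟩) }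

end SplittingGroup

/-! The strip `|Re w| ≤ δ` lies in the resolvent set, and the group forces the resolvent `R w` to be
`O(1/‖w‖)` there (`exists_isStripResolvent`). The contour integral of `R w` along `Re w = -δ`,
formally the spectral projection `P₁`, need not converge absolutely, and `P₁` may be unbounded. A
factor `1/w` repairs this and gives `V t = exp(tA) P₁ R(0)` (`leftSemigroup`), where `R(0) = -A⁻¹`;
the same construction for `-A` gives `V'`.

Three identities carry the splitting: `V s * V t = V (s + t) * V 0`, `V' 0 * V t = 0` and `V 0 - V'
0 = R 0`. With `E₁ = ker (V' 0)` and `E₂ = ker (V 0)`, the intersection lies in `ker (R 0) = 0`,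
while `D(A)`, the range of `R 0`, lies in `E₁ + E₂`. On `E₁` one has `V 0 = R 0`, so `V` is a
semigroup regularized by `R 0`.

The group removes the regularization. On a dense set, `exp((t + is)A) = exp(tA) U(s)` is holomorphic
for `t > 0`, and `U` controls it on vertical lines. Three lines on `0 ≤ Re z ≤ T` and Cauchy's
estimate bound `A exp(TA/2) x` by the power `3/4` of the growth ratio `ρ` between the two edges; up
to sign the bounded operator `V (T/2)` maps this vector to `exp(TA) x`. So `ρ ≤ L ρ^(3/4)` unless `ρ
= 1`, an a priori bound (`exists_smoothing`). Hence `exp(tA)` is a bounded semigroup on `E₁`,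
holomorphic on the half-plane (`exists_semigroup`).

For the spectra: resolvents of `A` restrict to `E₁` and `E₂`; boundedness of the semigroups puts `Re
μ > 0` in `ρ(A₁)` and `Re μ < 0` in `ρ(A₂)`; and a point of `ρ(A₁) ∩ ρ(A₂)` is in `ρ(A)`
(`mem_resolventSet_of_restrict`). -/

namespace SplittingGroup

/-! ### Resolvents through graphs, and exponential bounds for semigroups and groups. -/

variable {E : Type*} [NormedAddCommGroup E] [NormedSpace ℂ E]

/-- `R` is the resolvent `(μ - A)⁻¹`, expressed through the graph of `A`. -/
structure IsResolvent (A : E →ₗ.[ℂ] E) (μ : ℂ) (R : E →L[ℂ] E) : Prop where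
  left_inv : ∀ x y : E, (x, y) ∈ A.graph → R (μ • x - y) = x
  mem_graph : ∀ y : E, (R y, μ • R y - y) ∈ A.graph

theorem mem_resolventSet_iff {A : E →ₗ.[ℂ] E} {μ : ℂ} :
    μ ∈ resolventSet A ↔ ∃ R, IsResolvent A μ R := by
  constructor
  · rintro ⟨R, h1, h2⟩
    refine ⟨R, ?_, ?_⟩
    · intro x y hxy
      obtain ⟨z, rfl, rfl⟩ := A.mem_graph_iff.1 hxy
      exact h1 z
    · intro y
      obtain ⟨h, hy⟩ := h2 y
      refine A.mem_graph_iff.2 ⟨⟨R y, h⟩, rfl, ?_⟩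
      exact (sub_eq_of_eq_add (sub_eq_iff_eq_add'.1 hy)).symm
  · rintro ⟨R, h⟩
    refine ⟨R, fun x => h.left_inv _ _ (A.mem_graph x), fun y => ?_⟩
    obtain ⟨z, hz1, hz2⟩ := A.mem_graph_iff.1 (h.mem_graph y)
    simp only at hz1 hz2
    refine ⟨hz1 ▸ z.2, ?_⟩
    have : (⟨R y, hz1 ▸ z.2⟩ : A.domain) = z := Subtype.ext hz1.symm
    rw [this, hz2]; abel

theorem mem_graph_neg {A : E →ₗ.[ℂ] E} {x y : E} : (x, y) ∈ (-A).graph ↔ (x, -y) ∈ A.graph := by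
  simp only [LinearPMap.mem_graph_iff, LinearPMap.neg_apply]
  constructor
  · rintro ⟨z, h1, h2⟩; exact ⟨z, h1, by simp [← h2]⟩
  · rintro ⟨z, h1, h2⟩; exact ⟨z, h1, by simp [h2]⟩

namespace IsResolvent

variable {A : E →ₗ.[ℂ] E} {μ ν : ℂ} {R S : E →L[ℂ] E}

theorem sub_eq (hR : IsResolvent A μ R) (hS : IsResolvent A ν S) :
    R - S = (ν - μ) • (R * S) := by
  ext y
  have h := hR.left_inv _ _ (hS.mem_graph y)
  have e : μ • S y - (ν • S y - y) = y - (ν - μ) • S y := by module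
  rw [e, map_sub, map_smul] at h
  simp only [sub_apply, smul_apply,
    mul_apply_eq_comp]
  exact (eq_sub_of_add_eq' (sub_eq_iff_eq_add.1 h).symm).symm

theorem unique (hR : IsResolvent A μ R) (hS : IsResolvent A μ S) : R = S := by
  have := hR.sub_eq hS
  rwa [sub_self, zero_smul, sub_eq_zero] at this

theorem injective (hR : IsResolvent A μ R) : Function.Injective R := by
  rw [injective_iff_map_eq_zero]
  intro y hy
  have h := hR.mem_graph y
  rw [hy] at h
  have := A.graph_fst_eq_zero_snd h rfl
  simpa using this

theorem neg (hR : IsResolvent A μ R) : IsResolvent (-A) (-μ) (-R) := by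
  refine ⟨fun x y h => ?_, fun y => ?_⟩
  · have := hR.left_inv _ _ (mem_graph_neg.1 h)
    rw [neg_apply, ← map_neg]
    convert this using 2
    module
  · rw [mem_graph_neg]
    have := A.graph.smul_mem (-1 : ℂ) (hR.mem_graph y)
    convert this using 1
    ext
    · simp
    · simp only [neg_apply, Prod.smul_snd]
      module

theorem commute (hR : IsResolvent A μ R) {B : E →L[ℂ] E}
    (hB : ∀ x y, (x, y) ∈ A.graph → (B x, B y) ∈ A.graph) : Commute B R := by
  ext y
  have := hR.left_inv _ _ (hB _ _ (hR.mem_graph y))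
  simp only [mul_apply_eq_comp]
  rw [← this]; simp

theorem commute_resolvent (hR : IsResolvent A μ R) (hS : IsResolvent A ν S) : Commute R S := by
  refine hS.commute fun x y h => ?_
  have e : R y = μ • R x - x := by
    have := hR.left_inv _ _ h
    rw [map_sub, map_smul] at this
    exact (sub_eq_of_eq_add (sub_eq_iff_eq_add'.1 this)).symm
  rw [e]; exact hR.mem_graph x

theorem mem_graph_iff (hR : IsResolvent A 0 R) {x y : E} : (x, y) ∈ A.graph ↔ x = -R y := by
  constructor
  · intro h
    have := hR.left_inv _ _ h
    simpa using this.symm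
  · rintro rfl
    have := hR.mem_graph (-y)
    simpa using this

end IsResolvent

theorem mem_graph_smul {A : E →ₗ.[ℂ] E} {a : ℂ} (ha : a ≠ 0) {x y : E} :
    (x, y) ∈ (a • A).graph ↔ (x, a⁻¹ • y) ∈ A.graph := by
  simp only [LinearPMap.mem_graph_iff, LinearPMap.smul_apply]
  constructor
  · rintro ⟨z, h1, h2⟩; exact ⟨z, h1, by simp [← h2, ha]⟩
  · rintro ⟨z, h1, h2⟩; exact ⟨z, h1, by simp [h2, ha]⟩

theorem mem_graph_shift {A : E →ₗ.[ℂ] E} {ω : ℝ} {x y : E} :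
    (x, y) ∈ (shift A ω).graph ↔ (x, y + (ω : ℂ) • x) ∈ A.graph := by
  simp only [shift, LinearPMap.mem_graph_iff, LinearPMap.vadd_apply]
  constructor
  · rintro ⟨z, h1, h2⟩; exact ⟨z, h1, by simp [← h2, ← h1]⟩
  · rintro ⟨z, h1, h2⟩; exact ⟨z, h1, by simp [h2, ← h1]⟩

theorem mem_graph_restrict {A : E →ₗ.[ℂ] E} {F : Submodule ℂ E} {x y : F} :
    (x, y) ∈ (restrict A F).graph ↔ ((x : E), (y : E)) ∈ A.graph := by
  simp only [LinearPMap.mem_graph_iff]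
  constructor
  · rintro ⟨z, h1, h2⟩
    exact ⟨⟨_, z.2.1⟩, congrArg Subtype.val h1, congrArg Subtype.val h2⟩
  · rintro ⟨z, h1, h2⟩
    have hx : (x : E) ∈ A.domain := h1 ▸ z.2
    have hz : A ⟨x, hx⟩ = y := by
      rw [← h2]
      exact congrArg A (Subtype.ext h1.symm)
    have hy : A ⟨x, hx⟩ ∈ F := by rw [hz]; exact y.2
    exact ⟨⟨x, ⟨hx, hy⟩⟩, rfl, Subtype.ext hz⟩

theorem IsC0Semigroup.exists_bound [CompleteSpace E] {T : ℝ → E →L[ℂ] E} (hT : IsC0Semigroup T) :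
    ∃ M ω : ℝ, 0 ≤ M ∧ 0 ≤ ω ∧ ∀ t, 0 ≤ t → ‖T t‖ ≤ M * Real.exp (ω * t) := by
  obtain ⟨C, hC⟩ : ∃ C, ∀ i : Icc (0 : ℝ) 1, ‖T i‖ ≤ C := by
    refine banach_steinhaus fun x => ?_
    obtain ⟨C, hC⟩ := isCompact_Icc.exists_bound_of_continuousOn
      ((hT.strong_cont x).mono (Icc_subset_Ici_self : Icc (0 : ℝ) 1 ⊆ Ici 0))
    exact ⟨C, fun i => hC i i.2⟩
  set K := max C 1 with hK
  have hK1 : 1 ≤ K := le_max_right _ _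
  have hK' : ∀ t ∈ Icc (0 : ℝ) 1, ‖T t‖ ≤ K := fun t ht => (hC ⟨t, ht⟩).trans (le_max_left _ _)
  have hn : ∀ n : ℕ, ∀ t ∈ Icc (0 : ℝ) 1, ‖T (n + t)‖ ≤ K ^ (n + 1) := by
    intro n
    induction n with
    | zero => intro t ht; simpa using hK' t ht
    | succ n ih =>
      intro t ht
      have e : ((n + 1 : ℕ) : ℝ) + t = 1 + (n + t) := by push_cast; ring
      rw [e, hT.map_add _ _ zero_le_one (by have := ht.1; positivity)]
      refine (ContinuousLinearMap.opNorm_comp_le _ _).trans ?_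
      rw [pow_succ' K (n + 1)]
      exact mul_le_mul (hK' 1 (by simp)) (ih t ht) (norm_nonneg _) (by positivity)
  refine ⟨K, Real.log K, by positivity, Real.log_nonneg hK1, fun t ht => ?_⟩
  have hfl := Nat.floor_le ht
  have h1 := hn ⌊t⌋₊ (t - ⌊t⌋₊) ⟨by linarith, by have := Nat.lt_floor_add_one t; linarith⟩
  rw [add_sub_cancel, pow_succ'] at h1
  refine h1.trans (mul_le_mul_of_nonneg_left ?_ (by positivity))
  rw [← Real.rpow_def_of_pos (by positivity), ← Real.rpow_natCast]
  exact Real.rpow_le_rpow_of_exponent_le hK1 hfl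

theorem IsC0Group.isC0Semigroup {U : ℝ → E →L[ℂ] E} (hU : IsC0Group U) : IsC0Semigroup U :=
  ⟨hU.map_zero, fun s t _ _ => hU.map_add s t, fun x => (hU.strong_cont x).continuousOn⟩

theorem IsC0Group.reverse {U : ℝ → E →L[ℂ] E} (hU : IsC0Group U) :
    IsC0Group (fun t => U (-t)) :=
  ⟨by simp [hU.map_zero], fun s t => by rw [neg_add, hU.map_add],
    fun x => (hU.strong_cont x).comp continuous_neg⟩

theorem IsC0Group.exists_bound [CompleteSpace E] {U : ℝ → E →L[ℂ] E} (hU : IsC0Group U) :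
    ∃ M ω : ℝ, 0 ≤ M ∧ 0 ≤ ω ∧ ∀ t, ‖U t‖ ≤ M * Real.exp (ω * |t|) := by
  obtain ⟨M, ω, hM, hω, h⟩ := hU.isC0Semigroup.exists_bound
  obtain ⟨M', ω', hM', hω', h'⟩ := hU.reverse.isC0Semigroup.exists_bound
  refine ⟨max M M', max ω ω', le_max_of_le_left hM, le_max_of_le_left hω, fun t => ?_⟩
  rcases le_total 0 t with ht | ht
  · refine (h t ht).trans ?_
    rw [abs_of_nonneg ht]
    gcongr
    · exact le_max_left _ _
    · exact le_max_left _ _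
  · have := h' (-t) (by linarith)
    rw [neg_neg] at this
    refine this.trans ?_
    rw [abs_of_nonpos ht]
    have : 0 ≤ -t := by linarith
    gcongr
    · exact le_max_right _ _
    · exact le_max_right _ _

end SplittingGroup

/-! ### The Laplace transform of a semigroup. -/

namespace SplittingGroup

open MeasureTheory

variable {E : Type*} [NormedAddCommGroup E] [NormedSpace ℂ E]

theorem ofReal_inv_smul (h : ℝ) (x : E) : (h : ℂ)⁻¹ • x = h⁻¹ • x := by
  rw [← Complex.ofReal_inv, Complex.coe_smul]

theorem integral_Ioi_comp_add_right (f : ℝ → E) (h : ℝ) :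
    ∫ t in Ioi (0 : ℝ), f (t + h) = ∫ t in Ioi h, f t := by
  have := (measurePreserving_add_right (volume : Measure ℝ) h).setIntegral_preimage_emb
    (measurableEmbedding_addRight h) f (Ioi h)
  rw [← this]
  simp

section Average

variable [CompleteSpace E]

theorem tendsto_average {g : ℝ → E} (hg : ContinuousOn g (Ici 0)) :
    Tendsto (fun h : ℝ => (h : ℂ)⁻¹ • ∫ t in (0 : ℝ)..h, g t) (𝓝[>] 0) (𝓝 (g 0)) := by
  have hc : Continuous (fun t => g (max t 0)) :=
    hg.comp_continuous (by fun_prop) fun t => mem_Ici.2 (le_max_right _ _)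
  have hd := (hc.integral_hasStrictDerivAt 0 0).hasDerivAt.tendsto_slope_zero_right
  simp only [intervalIntegral.integral_same, sub_zero, zero_add, max_self] at hd
  refine hd.congr' ?_
  filter_upwards [self_mem_nhdsWithin] with h hh
  rw [ofReal_inv_smul]
  congr 1
  refine intervalIntegral.integral_congr fun t ht => ?_
  rw [uIcc_of_le (le_of_lt hh)] at ht
  simp [max_eq_left ht.1]

/-- The Laplace transform of a semigroup is the resolvent of its generator. -/
theorem IsC0Semigroup.exists_isResolvent {T : ℝ → E →L[ℂ] E} (hT : IsC0Semigroup T)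
    {A : E →ₗ.[ℂ] E} (hA : IsSemigroupGenerator T A) {M ω : ℝ}
    (hM : ∀ t, 0 ≤ t → ‖T t‖ ≤ M * Real.exp (ω * t)) {μ : ℂ} (hμ : ω < μ.re) :
    ∃ R, IsResolvent A μ R ∧ ‖R‖ ≤ M / (μ.re - ω) := by
  have hM0 : 0 ≤ M := by
    have := (norm_nonneg _).trans (hM 0 le_rfl)
    simpa using this
  set f : E → ℝ → E := fun x t => Complex.exp (-μ * t) • T t x with hf
  have hcont : ∀ x, ContinuousOn (f x) (Ici 0) := fun x =>
    ContinuousOn.smul (by fun_prop) (hT.strong_cont x)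
  have hbd : ∀ x, ∀ t ∈ Ioi (0 : ℝ), ‖f x t‖ ≤ M * ‖x‖ * Real.exp ((-(μ.re - ω)) * t) := by
    intro x t ht
    rw [hf, norm_smul, Complex.norm_exp]
    have h1 := (T t).le_of_opNorm_le (hM t (le_of_lt ht)) x
    have h2 : (-μ * (t : ℂ)).re = -μ.re * t := by simp
    rw [h2]
    calc _ ≤ Real.exp (-μ.re * t) * (M * Real.exp (ω * t) * ‖x‖) := by gcongr
      _ = M * ‖x‖ * (Real.exp (-μ.re * t) * Real.exp (ω * t)) := by ring
      _ = _ := by rw [← Real.exp_add]; ring_nf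
  have hdom : ∀ x : E, IntegrableOn (fun t => M * ‖x‖ * Real.exp ((-(μ.re - ω)) * t))
      (Ioi (0 : ℝ)) := fun x =>
    (exp_neg_integrableOn_Ioi 0 (b := μ.re - ω) (by linarith)).const_mul _
  have hint : ∀ x, IntegrableOn (f x) (Ioi 0) := fun x =>
    Integrable.mono' (hdom x)
      (((hcont x).mono Ioi_subset_Ici_self).aestronglyMeasurable measurableSet_Ioi)
      ((ae_restrict_iff' measurableSet_Ioi).2 (Eventually.of_forall (hbd x)))
  let L : E →ₗ[ℂ] E :=
    { toFun := fun x => ∫ t in Ioi (0 : ℝ), f x t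
      map_add' := fun x y => by
        rw [← integral_add (hint x) (hint y)]
        simp [hf]
      map_smul' := fun c x => by
        rw [RingHom.id_apply, ← integral_smul]
        simp only [hf, map_smul]
        congr 1; ext t; rw [smul_comm] }
  have hL : ∀ x, ‖L x‖ ≤ M / (μ.re - ω) * ‖x‖ := by
    intro x
    calc ‖L x‖ ≤ ∫ t in Ioi (0 : ℝ), M * ‖x‖ * Real.exp ((-(μ.re - ω)) * t) :=
          norm_integral_le_of_norm_le (hdom x)
            ((ae_restrict_iff' measurableSet_Ioi).2 (Eventually.of_forall (hbd x)))
      _ = _ := by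
          rw [integral_const_mul, integral_exp_mul_Ioi (by linarith)]
          have h1 : μ.re - ω ≠ 0 := by linarith
          rw [mul_zero, Real.exp_zero, neg_div_neg_eq]
          field_simp
  let R : E →L[ℂ] E := L.mkContinuous _ hL
  have hR : ∀ x, R x = ∫ t in Ioi (0 : ℝ), f x t := fun x => rfl
  -- Translating the Laplace integral by `h` costs the factor `exp (μ h)` and the piece over `[0,
  -- h]`; dividing by `h` yields the generator on the range of `R`.
  have hshift : ∀ x, ∀ h : ℝ, 0 ≤ h →
      T h (R x) = Complex.exp (μ * h) • (R x - ∫ t in (0 : ℝ)..h, f x t) := by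
    intro x h hh
    have e1 : T h (R x) = ∫ t in Ioi (0 : ℝ), Complex.exp (μ * h) • f x (t + h) := by
      rw [hR, ← ContinuousLinearMap.integral_comp_comm _ (hint x)]
      refine setIntegral_congr_fun measurableSet_Ioi fun t ht => ?_
      simp only [hf, map_smul, smul_smul, ← Complex.exp_add]
      rw [add_comm t h, hT.map_add h t hh (le_of_lt ht)]
      simp only [ContinuousLinearMap.comp_apply]
      congr 2
      push_cast; ring
    rw [e1, integral_smul, integral_Ioi_comp_add_right, hR,
      ← intervalIntegral.integral_interval_add_Ioi (hint x)
        ((hint x).mono_set (Ioi_subset_Ioi hh))]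
    simp
  have hquot : ∀ x, Tendsto (fun h : ℝ => (h : ℂ)⁻¹ • (T h (R x) - R x)) (𝓝[>] 0)
      (𝓝 (μ • R x - x)) := by
    intro x
    have h1 : Tendsto (fun h : ℝ => h⁻¹ • (Complex.exp (μ * h) - 1)) (𝓝[>] 0) (𝓝 μ) := by
      have : HasDerivAt (fun h : ℝ => Complex.exp (μ * h)) μ 0 := by
        have := ((Complex.ofRealCLM.hasDerivAt (x := 0)).const_mul μ).cexp
        simpa using this
      have := this.tendsto_slope_zero_right
      simpa using this
    have h2 : Tendsto (fun h : ℝ => Complex.exp (μ * h)) (𝓝[>] 0) (𝓝 1) := by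
      have : Continuous (fun h : ℝ => Complex.exp (μ * h)) := by fun_prop
      have := this.tendsto 0
      simp only [Complex.ofReal_zero, mul_zero, Complex.exp_zero] at this
      exact this.mono_left nhdsWithin_le_nhds
    have h3 := tendsto_average (hcont x)
    have h0 : f x 0 = x := by simp [hf, hT.map_zero]
    rw [h0] at h3
    have h4 := (h1.smul_const (R x)).sub (h2.smul h3)
    rw [one_smul] at h4
    refine h4.congr' ?_
    filter_upwards [self_mem_nhdsWithin] with h hh
    rw [hshift x h (le_of_lt hh), ofReal_inv_smul, ofReal_inv_smul]
    rw [smul_assoc, sub_smul, one_smul, smul_comm (Complex.exp _) h⁻¹, ← smul_sub]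
    congr 1
    rw [smul_sub]; abel
  have hcomm : ∀ x, ∀ h : ℝ, 0 ≤ h → R (T h x) = T h (R x) := by
    intro x h hh
    rw [hR, hR, ← ContinuousLinearMap.integral_comp_comm _ (hint x)]
    refine setIntegral_congr_fun measurableSet_Ioi fun t ht => ?_
    have e := hT.map_add h t hh (le_of_lt ht)
    rw [add_comm, hT.map_add t h (le_of_lt ht) hh] at e
    simp only [hf, map_smul]
    exact congrArg _ (DFunLike.congr_fun e x)
  refine ⟨R, ⟨fun x y hxy => ?_, fun y => (hA _ _).2 (hquot y)⟩, ?_⟩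
  · have h1 := (hA _ _).1 hxy
    have h2 := (R.continuous.tendsto y).comp h1
    have h3 : Tendsto (fun h : ℝ => (h : ℂ)⁻¹ • (T h (R x) - R x)) (𝓝[>] 0) (𝓝 (R y)) := by
      refine h2.congr' ?_
      filter_upwards [self_mem_nhdsWithin] with h hh
      simp [hcomm x h (le_of_lt hh)]
    have h4 := tendsto_nhds_unique h3 (hquot x)
    rw [map_sub, map_smul, h4]
    simp
  · exact L.mkContinuous_norm_le (div_nonneg hM0 (by linarith)) hL

end Average

end SplittingGroup

/-! ### A three lines theorem, and norm differentiability after regularization. -/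

namespace SplittingGroup

section ThreeLines

variable {X : Type*} [NormedAddCommGroup X] [NormedSpace ℂ X]

open Complex in
/-- Hadamard's three lines theorem for functions that grow exponentially along the strip. -/
theorem exists_three_lines_const (T ω : ℝ) (hT : 0 < T) :
    ∃ K : ℝ, 0 < K ∧ ∀ (F : ℂ → X) (a b B : ℝ),
      ContinuousOn F {z | 0 ≤ z.re} → DifferentiableOn ℂ F {z | 0 < z.re} →
      (∀ z : ℂ, 0 ≤ z.re → ‖F z‖ ≤ B * Real.exp (ω * |z.im|)) → 0 ≤ a → 0 ≤ b →
      (∀ z : ℂ, z.re = 0 → ‖F z‖ ≤ a * Real.exp (ω * |z.im|)) →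
      (∀ z : ℂ, z.re = T → ‖F z‖ ≤ b * Real.exp (ω * |z.im|)) →
      ∀ z : ℂ, 0 ≤ z.re → z.re ≤ T → |z.im| ≤ T →
        ‖F z‖ ≤ K * (a ^ (1 - z.re / T) * b ^ (z.re / T)) := by
  -- The multiplier `exp (w²)` has modulus `exp (x² - y²)`, which beats `exp (ω|y|)`: their product
  -- is at most `K₀` on the strip. The extra `exp (T²)` below undoes the multiplier where `|y| ≤ T`.
  -- The a priori bound `B` does not enter the constant.
  set K₀ := Real.exp (T ^ 2 + ω ^ 2) with hK₀
  have hK₀pos : 0 < K₀ := Real.exp_pos _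
  refine ⟨Real.exp (T ^ 2) * K₀, by positivity, ?_⟩
  intro F a b B hc hd hB ha hb ha' hb' z hz0 hzT hzi
  have hexp : ∀ w : ℂ, ‖exp (w ^ 2)‖ = Real.exp (w.re ^ 2 - w.im ^ 2) := by
    intro w
    rw [norm_exp]
    congr 1
    simp [sq]
  have hmul : ∀ (w : ℂ) (c : ℝ), 0 ≤ c → 0 ≤ w.re → w.re ≤ T →
      ‖F w‖ ≤ c * Real.exp (ω * |w.im|) → ‖exp (w ^ 2) • F w‖ ≤ K₀ * c := by
    intro w c hc0 h0 h1 h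
    rw [norm_smul, hexp]
    calc _ ≤ Real.exp (w.re ^ 2 - w.im ^ 2) * (c * Real.exp (ω * |w.im|)) := by gcongr
      _ = c * Real.exp (w.re ^ 2 - w.im ^ 2 + ω * |w.im|) := by rw [Real.exp_add]; ring
      _ ≤ c * K₀ := by
        have : w.re ^ 2 ≤ T ^ 2 := by gcongr
        refine mul_le_mul_of_nonneg_left (Real.exp_le_exp.2 ?_) hc0
        nlinarith [sq_abs w.im, sq_nonneg (ω - |w.im|), sq_nonneg ω, sq_nonneg (|w.im|)]
      _ = _ := by ring
  have hB0 : 0 ≤ B := by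
    have := (norm_nonneg _).trans (hB 0 (by simp))
    simpa using this
  have key := HadamardThreeLines.norm_le_interp_of_mem_verticalClosedStrip'
    (f := fun w => exp (w ^ 2) • F w) (z := z) (a := K₀ * a) (b := K₀ * b) hT ⟨hz0, hzT⟩ ?_ ?_ ?_ ?_
  · simp only [sub_zero] at key
    rw [Real.mul_rpow hK₀pos.le ha, Real.mul_rpow hK₀pos.le hb] at key
    rw [norm_smul, hexp] at key
    have h1 : 1 ≤ Real.exp (T ^ 2) * Real.exp (z.re ^ 2 - z.im ^ 2) := by
      rw [← Real.exp_add, Real.one_le_exp_iff]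
      have : z.im ^ 2 ≤ T ^ 2 := by rw [← sq_abs z.im]; gcongr
      nlinarith [sq_nonneg z.re]
    have h2 : K₀ ^ (1 - z.re / T) * K₀ ^ (z.re / T) = K₀ := by
      rw [← Real.rpow_add hK₀pos]; simp
    calc ‖F z‖ ≤ (Real.exp (T ^ 2) * Real.exp (z.re ^ 2 - z.im ^ 2)) * ‖F z‖ :=
          le_mul_of_one_le_left (norm_nonneg _) h1
      _ = Real.exp (T ^ 2) * (Real.exp (z.re ^ 2 - z.im ^ 2) * ‖F z‖) := by ring
      _ ≤ Real.exp (T ^ 2) * _ := mul_le_mul_of_nonneg_left key (Real.exp_pos _).le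
      _ = Real.exp (T ^ 2) * (K₀ ^ (1 - z.re / T) * K₀ ^ (z.re / T)) *
          (a ^ (1 - z.re / T) * b ^ (z.re / T)) := by ring
      _ = _ := by rw [h2]
  · refine ⟨?_, ?_⟩
    · refine DifferentiableOn.smul (by fun_prop) (hd.mono ?_)
      intro w hw
      exact hw.1
    · have hcl : closure (HadamardThreeLines.verticalStrip 0 T) ⊆ {z : ℂ | 0 ≤ z.re} := by
        refine closure_minimal (fun w hw => ?_) (isClosed_le continuous_const continuous_re)
        exact le_of_lt hw.1
      exact ContinuousOn.smul (by fun_prop) (hc.mono hcl)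
  · refine ⟨K₀ * B, ?_⟩
    rintro _ ⟨w, hw, rfl⟩
    exact hmul w B hB0 hw.1 hw.2 (hB w hw.1)
  · intro w hw
    have hw : w.re = 0 := hw
    exact hmul w a ha hw.ge (hw.le.trans hT.le) (ha' w hw)
  · intro w hw
    have hw : w.re = T := hw
    exact hmul w b hb (hT.le.trans hw.ge) hw.le (hb' w hw)

end ThreeLines

section Regularize

variable {X : Type*} [NormedAddCommGroup X] [NormedSpace ℂ X]

/-- Strong differentiability becomes differentiability in norm after one more regularization. -/
theorem hasDerivAt_mul_sq {Q : ℝ → X →L[ℂ] X} {R : X →L[ℂ] X} {κ : ℂ} {t₀ ε C : ℝ} (hε : 0 < ε)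
    (hd : ∀ t ∈ Metric.ball t₀ ε, ∀ x, HasDerivAt (fun s => Q s (R x)) (κ • Q t x) t)
    (hC : ∀ t ∈ Metric.ball t₀ ε, ‖Q t‖ ≤ C) :
    HasDerivAt (fun t => Q t * (R * R)) (κ • (Q t₀ * R)) t₀ := by
  have h1 : ∀ t ∈ Metric.ball t₀ ε, ∀ x, ‖Q t (R x) - Q t₀ (R x)‖ ≤ ‖κ‖ * (C * ‖x‖) * ‖t - t₀‖ := by
    intro t ht x
    refine (convex_ball t₀ ε).norm_image_sub_le_of_norm_hasDerivWithin_le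
      (fun s hs => (hd s hs x).hasDerivWithinAt) (fun s hs => ?_) (Metric.mem_ball_self hε) ht
    rw [norm_smul]
    gcongr
    exact (Q s).le_of_opNorm_le (hC s hs) x
  have hC0 : 0 ≤ C := (norm_nonneg _).trans (hC t₀ (Metric.mem_ball_self hε))
  -- A second use of the mean value inequality, now for the remainder, whose derivative is
  -- controlled by the Lipschitz bound `h1`; the error is quadratic in `t - t₀`, uniformly over unit
  -- vectors.
  have h2 : ∀ t ∈ Metric.ball t₀ ε,
      ‖Q t * (R * R) - Q t₀ * (R * R) - (t - t₀) • (κ • (Q t₀ * R))‖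
        ≤ ‖κ‖ * (‖κ‖ * C) * ‖(t - t₀) ^ 2‖ := by
    intro t ht
    refine ContinuousLinearMap.opNorm_le_bound _ (by positivity) fun x => ?_
    have hsub : Metric.closedBall t₀ ‖t - t₀‖ ⊆ Metric.ball t₀ ε := by
      refine Metric.closedBall_subset_ball ?_
      simpa [dist_eq_norm] using ht
    have hmv := (convex_closedBall t₀ ‖t - t₀‖).norm_image_sub_le_of_norm_hasDerivWithin_le
      (f := fun s : ℝ => Q s (R (R x)) - s • (κ • Q t₀ (R x)))
      (f' := fun s => κ • Q s (R x) - (1 : ℝ) • (κ • Q t₀ (R x)))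
      (C := ‖κ‖ * (‖κ‖ * (C * ‖x‖) * ‖t - t₀‖)) (x := t₀) (y := t)
      (fun s hs => ((hd s (hsub hs) (R x)).sub
        ((hasDerivAt_id s).smul_const _)).hasDerivWithinAt)
      (fun s hs => ?_) (Metric.mem_closedBall_self (norm_nonneg _))
      (by simp [dist_eq_norm])
    · refine le_trans (le_of_eq ?_) (hmv.trans (le_of_eq ?_))
      · congr 1
        simp only [sub_apply, mul_apply_eq_comp, smul_apply, sub_smul]
        abel
      · rw [norm_pow]; ring
    · rw [one_smul, ← smul_sub, norm_smul]
      gcongr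
      refine (h1 s (hsub hs) x).trans ?_
      gcongr
      simpa [dist_eq_norm] using hs
  rw [hasDerivAt_iff_isLittleO]
  have hO : (fun t => Q t * (R * R) - Q t₀ * (R * R) - (t - t₀) • (κ • (Q t₀ * R)))
      =O[𝓝 t₀] fun t => ‖t - t₀‖ ^ 2 :=
    Asymptotics.IsBigO.of_bound _ (by
      filter_upwards [Metric.ball_mem_nhds t₀ hε] with t ht
      simpa using h2 t ht)
  exact hO.trans_isLittleO (Asymptotics.isLittleO_pow_sub_sub t₀ one_lt_two)

end Regularize

end SplittingGroup

/-! ### Regularized semigroups and the smoothing estimate. -/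

namespace SplittingGroup

open MeasureTheory Complex

variable {X : Type*} [NormedAddCommGroup X] [NormedSpace ℂ X]

/-- A `C₀`-group `U` with generator `-i R⁻¹`, together with a bounded family `V` that behaves like
the semigroup generated by `-R⁻¹` composed with `R`. -/
structure RegularizedSemigroup (U : ℝ → X →L[ℂ] X) (R : X →L[ℂ] X) (V : ℝ → X →L[ℂ] X) :
    Prop where
  group : IsC0Group U
  injective : Function.Injective R
  group_comm : ∀ t, Commute (U t) R
  group_hasDerivAt : ∀ x t, HasDerivAt (fun s => U s (R x)) ((-I) • U t x) t
  comm : ∀ t, Commute (V t) R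
  group_comm' : ∀ s t, Commute (U s) (V t)
  map_zero : V 0 = R
  map_mul : ∀ s t, 0 ≤ s → 0 ≤ t → V s * V t = V (s + t) * R
  strong_cont : ∀ x, ContinuousOn (fun t => V t x) (Ici 0)
  hasDerivAt : ∀ x t, 0 < t → HasDerivAt (fun s => V s (R x)) ((-1 : ℂ) • V t x) t
  bounded : ∃ C, ∀ t, 0 ≤ t → ‖V t‖ ≤ C

theorem IsC0Group.inv_mul {U : ℝ → X →L[ℂ] X} (hU : IsC0Group U) (t : ℝ) (x : X) :
    U (-t) (U t x) = x := by
  have := hU.map_add (-t) t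
  rw [neg_add_cancel, hU.map_zero] at this
  exact (DFunLike.congr_fun this x).symm

namespace RegularizedSemigroup

variable {U V : ℝ → X →L[ℂ] X} {R : X →L[ℂ] X}

/-- Time averages of group orbits lie in the range of `R`. Since they converge to the starting
point, this range is dense. -/
theorem integral_group [CompleteSpace X] (h : RegularizedSemigroup U R V) (x : X) (s : ℝ) :
    ∫ r in (0 : ℝ)..s, U r x = R (I • (U s x - x)) := by
  have h1 := intervalIntegral.integral_eq_sub_of_hasDerivAt (a := 0) (b := s)
    (fun t _ => h.group_hasDerivAt x t)
    (((h.group.strong_cont x).const_smul (-I)).intervalIntegrable _ _)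
  rw [intervalIntegral.integral_smul] at h1
  have h2 : U s (R x) = R (U s x) := DFunLike.congr_fun (h.group_comm s).eq x
  rw [h.group.map_zero, h2] at h1
  have h3 := congrArg (fun y => I • y) h1
  simp only [smul_smul, mul_neg, I_mul_I, neg_neg, one_smul, ContinuousLinearMap.id_apply] at h3
  rw [h3, map_smul, map_sub]

theorem denseRange [CompleteSpace X] (h : RegularizedSemigroup U R V) : DenseRange R := by
  intro x
  have := tendsto_average (h.group.strong_cont x).continuousOn
  rw [h.group.map_zero] at this
  refine mem_closure_of_tendsto this (Eventually.of_forall fun s => ?_)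
  rw [h.integral_group, ← map_smul]
  exact mem_range_self _

theorem denseRange_pow [CompleteSpace X] (h : RegularizedSemigroup U R V) (n : ℕ) :
    DenseRange (R ^ n : X →L[ℂ] X) := by
  induction n with
  | zero => simpa using Function.surjective_id.denseRange
  | succ n ih =>
    rw [pow_succ]
    exact ih.comp h.denseRange (ContinuousLinearMap.continuous _)

theorem cancel_left (h : RegularizedSemigroup U R V) {P Q : X →L[ℂ] X} (e : R * P = R * Q) :
    P = Q := by
  ext x
  exact h.injective (DFunLike.congr_fun e x)

/-- The regularized holomorphic extension `exp(zA) R⁵`. -/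
noncomputable def orbit (U V : ℝ → X →L[ℂ] X) (R : X →L[ℂ] X) (z : ℂ) : X →L[ℂ] X :=
  (U z.im * (R * R)) * (V z.re * (R * R))

theorem orbit_eq (h : RegularizedSemigroup U R V) (z : ℂ) :
    orbit U V R z = U z.im * (V z.re * R ^ 4) := by
  have h1 := ((h.comm z.re).mul_right (h.comm z.re)).eq
  rw [orbit, mul_assoc, ← mul_assoc (R * R), ← h1]
  simp only [pow_succ, pow_zero, one_mul, mul_assoc]

/-- With `D = U V R³`, the partial derivatives in `Re z` and `Im z` are `-D` and `-iD`, which are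
the Cauchy–Riemann equations. Each factor carries its own `R²`, the price of differentiating in norm
by `hasDerivAt_mul_sq`. -/
theorem hasDerivAt_orbit [CompleteSpace X] (h : RegularizedSemigroup U R V) {z : ℂ}
    (hz : 0 < z.re) :
    HasDerivAt (orbit U V R) (-(U z.im * (V z.re * R ^ 3))) z := by
  obtain ⟨C, hC⟩ := h.bounded
  obtain ⟨M, ω, hM, hω, hU⟩ := h.group.exists_bound
  have ha : HasDerivAt (fun s => U s * (R * R)) ((-I) • (U z.im * R)) z.im := by
    refine hasDerivAt_mul_sq (C := M * Real.exp (ω * (|z.im| + 1))) one_pos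
      (fun t _ x => h.group_hasDerivAt x t) fun t ht => (hU t).trans ?_
    have h1 : |t - z.im| < 1 := by simpa [Real.dist_eq] using ht
    have h2 : |t| ≤ |z.im| + 1 := by
      have := abs_sub_abs_le_abs_sub t z.im
      linarith
    gcongr
  have hpos : ∀ t ∈ Metric.ball z.re z.re, 0 < t := by
    intro t ht
    have h1 : |t - z.re| < z.re := by simpa [Real.dist_eq] using ht
    linarith [(abs_lt.1 h1).1]
  have hb : HasDerivAt (fun s => V s * (R * R)) ((-1 : ℂ) • (V z.re * R)) z.re :=
    hasDerivAt_mul_sq (C := C) hz (fun t ht x => h.hasDerivAt x t (hpos t ht))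
      fun t ht => hC t (hpos t ht).le
  have ha' := ha.hasFDerivAt.comp z imCLM.hasFDerivAt
  have hb' := hb.hasFDerivAt.comp z reCLM.hasFDerivAt
  have hab := ha'.mul' hb'
  rw [hasDerivAt_iff_hasFDerivAt]
  refine hasFDerivAt_of_restrictScalars ℝ hab ?_
  refine ContinuousLinearMap.ext fun w => ?_
  have e1 : U z.im * R * (V z.re * (R * R)) = U z.im * (V z.re * R ^ 3) := by
    rw [mul_assoc, ← mul_assoc R, ← (h.comm z.re).eq]
    simp only [pow_succ, pow_zero, one_mul, mul_assoc]
  have e2 : U z.im * (R * R) * (V z.re * R) = U z.im * (V z.re * R ^ 3) := by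
    rw [mul_assoc, ← mul_assoc (R * R), ← ((h.comm z.re).mul_right (h.comm z.re)).eq]
    simp only [pow_succ, pow_zero, one_mul, mul_assoc]
  have e3 : w = (w.re : ℂ) + w.im * I := (re_add_im w).symm
  simp only [ContinuousLinearMap.coe_restrictScalars', ContinuousLinearMap.toSpanSingleton_apply,
    add_apply, smul_apply, Function.comp_apply, ContinuousLinearMap.comp_apply, reCLM_apply,
    imCLM_apply, smul_eq_mul, mul_smul_comm, smul_mul_assoc, e1, e2, MulOpposite.smul_eq_mul_unop,
    MulOpposite.unop_op]
  rw [← coe_smul w.re, ← coe_smul w.im]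
  conv_lhs => rw [e3]
  module

theorem continuousOn_orbit [CompleteSpace X] (h : RegularizedSemigroup U R V) (v : X) :
    ContinuousOn (fun z => orbit U V R z v) {z | 0 ≤ z.re} := by
  obtain ⟨M, ω, hM, hω, hU⟩ := h.group.exists_bound
  have hV : ContinuousOn (fun z : ℂ => V z.re ((R ^ 4) v)) {z | 0 ≤ z.re} :=
    (h.strong_cont _).comp continuous_re.continuousOn fun z hz => hz
  simp_rw [h.orbit_eq, mul_apply_eq_comp]
  intro z hz
  set y := V z.re ((R ^ 4) v) with hy
  have h1 : Tendsto (fun w : ℂ => U w.im (V w.re ((R ^ 4) v) - y)) (𝓝[{z | 0 ≤ z.re}] z) (𝓝 0) := by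
    have h2 : Tendsto (fun w : ℂ => M * Real.exp (ω * |w.im|) * ‖V w.re ((R ^ 4) v) - y‖)
        (𝓝[{z | 0 ≤ z.re}] z) (𝓝 (M * Real.exp (ω * |z.im|) * 0)) := by
      refine Tendsto.mul ?_ ?_
      · have : Continuous fun w : ℂ => M * Real.exp (ω * |w.im|) := by fun_prop
        exact (this.tendsto z).mono_left nhdsWithin_le_nhds
      · exact tendsto_iff_norm_sub_tendsto_zero.1 (hV z hz)
    rw [mul_zero] at h2
    exact squeeze_zero_norm (fun w => (U w.im).le_of_opNorm_le (hU _) _) h2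
  have h3 : Tendsto (fun w : ℂ => U w.im y) (𝓝[{z | 0 ≤ z.re}] z) (𝓝 (U z.im y)) :=
    ((((h.group.strong_cont y).comp continuous_im).tendsto z)).mono_left nhdsWithin_le_nhds
  have h4 := h1.add h3
  simp only [← map_add, sub_add_cancel, zero_add] at h4
  exact h4

/-- The smoothing estimates: on the semigroup generated by `-R⁻¹`, the three lines theorem and
Cauchy's estimate bound `exp(tA)` and `A exp(tA)` independently of the regularization. -/
theorem exists_smoothing [CompleteSpace X] (h : RegularizedSemigroup U R V) {T : ℝ} (hT : 0 < T) :
    ∃ C, 0 ≤ C ∧ ∀ v, ‖V (T / 2) ((R ^ 3) v)‖ ≤ C * ‖(R ^ 5) v‖ ∧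
      ∀ t, 0 ≤ t → t ≤ T → ‖V t ((R ^ 4) v)‖ ≤ C * ‖(R ^ 5) v‖ := by
  obtain ⟨CV, hCV⟩ := h.bounded
  have hCV0 : 0 ≤ CV := (norm_nonneg _).trans (hCV 0 le_rfl)
  obtain ⟨M, ω, hM, hω, hU⟩ := h.group.exists_bound
  obtain ⟨K, hK, hKF⟩ := exists_three_lines_const (X := X) T ω hT
  set L := M * CV * (4 / T * K) with hL
  have hL0 : 0 ≤ L := by positivity
  set ρm := 1 + L ^ 4 with hρm
  have hρm0 : 1 ≤ ρm := by have : 0 ≤ L ^ 4 := by positivity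
                           linarith
  refine ⟨max (4 / T) 1 * K * M * ρm, by positivity, fun v => ?_⟩
  rcases eq_or_ne v 0 with rfl | hv
  · simp
  have hinj : Function.Injective (R ^ 5 : X →L[ℂ] X) := by
    have : ⇑(R ^ 5 : X →L[ℂ] X) = R ∘ R ∘ R ∘ R ∘ R := by ext x; simp [pow_succ]
    rw [this]
    exact h.injective.comp <| h.injective.comp <| h.injective.comp <| h.injective.comp h.injective
  have hx : 0 < ‖(R ^ 5) v‖ := by
    rw [norm_pos_iff]
    intro h0
    exact hv (hinj (by simpa using h0))
  set F : ℂ → X := fun z => orbit U V R z v with hF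
  have hFeq : ∀ z, F z = U z.im (V z.re ((R ^ 4) v)) := fun z => by
    simp only [hF, h.orbit_eq, mul_apply_eq_comp]
  have hFn : ∀ z : ℂ, ‖F z‖ ≤ M * ‖V z.re ((R ^ 4) v)‖ * Real.exp (ω * |z.im|) := fun z => by
    rw [hFeq]
    refine ((U z.im).le_of_opNorm_le (hU _) _).trans (le_of_eq ?_)
    ring
  have hderiv : ∀ z : ℂ, 0 < z.re → HasDerivAt F (-(U z.im (V z.re ((R ^ 3) v)))) z := by
    intro z hz
    have := (h.hasDerivAt_orbit hz).clm_apply (hasDerivAt_const z v)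
    simpa using this
  have hMpos : 0 < M := by
    have := hU 0
    rw [h.group.map_zero] at this
    rcases hM.lt_or_eq with h0 | h0
    · exact h0
    · rw [← h0, zero_mul] at this
      have h1 : v = 0 := by
        have h2 := (ContinuousLinearMap.id ℂ X).le_of_opNorm_le this v
        simpa using h2
      exact absurd h1 hv
  -- The vector `R⁵ v` is the value of the orbit at `0`. Up to the factor `exp (ω|Im z|)`, `a`
  -- bounds the orbit on `Re z = 0` and `b` on `Re z = T`; the maximum in `b` ensures `ρ ≥ 1`, so
  -- that powers of `ρ` increase with the exponent.
  set a := M * ‖(R ^ 5) v‖ with ha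
  have ha0 : 0 < a := by positivity
  set b := max a (M * ‖V T ((R ^ 4) v)‖) with hb
  have hb0 : 0 < b := lt_max_of_lt_left ha0
  set ρ := b / a with hρ
  have hρ1 : 1 ≤ ρ := (one_le_div ha0).2 (le_max_left _ _)
  have hρ0 : 0 < ρ := by positivity
  have hV0 : V 0 ((R ^ 4) v) = (R ^ 5) v := by
    rw [h.map_zero, ← mul_apply_eq_comp, ← pow_succ']
  have key : ∀ z : ℂ, 0 ≤ z.re → z.re ≤ T → |z.im| ≤ T → ‖F z‖ ≤ K * (a * ρ ^ (z.re / T)) := by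
    intro z h0 h1 h2
    have := hKF F a b (M * (CV * ‖(R ^ 4) v‖)) (h.continuousOn_orbit v)
      (fun z hz => (hderiv z hz).differentiableAt.differentiableWithinAt)
      (fun z hz => (hFn z).trans (by gcongr; exact (V z.re).le_of_opNorm_le (hCV _ hz) _))
      ha0.le hb0.le
      (fun z hz => by have := hFn z; rwa [hz, hV0] at this)
      (fun z hz => by
        have := hFn z
        rw [hz] at this
        refine this.trans ?_
        gcongr
        exact le_max_right _ _) z h0 h1 h2
    rwa [Real.rpow_sub ha0, Real.rpow_one, div_mul_eq_mul_div, mul_div_assoc,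
      ← Real.div_rpow hb0.le ha0.le] at this
  -- Cauchy's estimate on the circle of radius `T/4` about `T/2`: it stays in `Re z ≤ 3T/4`, whence
  -- the exponent `3/4`.
  have hd : ‖V (T / 2) ((R ^ 3) v)‖ ≤ 4 / T * K * (a * ρ ^ (3 / 4 : ℝ)) := by
    have hsub : Metric.closedBall ((T / 2 : ℝ) : ℂ) (T / 4) ⊆
        {z : ℂ | T / 4 ≤ z.re ∧ z.re ≤ 3 * T / 4 ∧ |z.im| ≤ T} := by
      intro z hz
      rw [Metric.mem_closedBall, dist_eq_norm] at hz
      have h1 := (abs_re_le_norm _).trans hz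
      have h2 := (abs_im_le_norm _).trans hz
      simp only [sub_re, ofReal_re, sub_im, ofReal_im, sub_zero] at h1 h2
      obtain ⟨h3, h4⟩ := abs_le.1 h1
      exact ⟨by linarith, by linarith, by linarith⟩
    have hcauchy := norm_deriv_le_of_forall_mem_sphere_norm_le (c := ((T / 2 : ℝ) : ℂ))
      (R := T / 4) (C := K * (a * ρ ^ (3 / 4 : ℝ))) (f := F) (by positivity) ?_ ?_
    · rw [(hderiv _ (by simpa using hT)).deriv] at hcauchy
      simp only [ofReal_im, ofReal_re, h.group.map_zero, norm_neg,
        ContinuousLinearMap.id_apply] at hcauchy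
      refine hcauchy.trans (le_of_eq ?_)
      field_simp
    · refine DifferentiableOn.diffContOnCl fun z hz => ?_
      have := hsub (Metric.closure_ball_subset_closedBall hz)
      exact (hderiv z (by linarith [this.1])).differentiableAt.differentiableWithinAt
    · intro z hz
      have := hsub (Metric.sphere_subset_closedBall hz)
      refine (key z (by linarith [this.1]) (by linarith [this.2.1]) this.2.2).trans ?_
      refine mul_le_mul_of_nonneg_left (mul_le_mul_of_nonneg_left
        (Real.rpow_le_rpow_of_exponent_le hρ1 ?_) ha0.le) hK.le
      rw [div_le_iff₀ hT]; linarith [this.2.1]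
  have hVT : V T ((R ^ 4) v) = V (T / 2) (V (T / 2) ((R ^ 3) v)) := by
    have := h.map_mul (T / 2) (T / 2) (by positivity) (by positivity)
    rw [add_halves] at this
    rw [← mul_apply_eq_comp (V (T / 2)), this, mul_apply_eq_comp, ← mul_apply_eq_comp R,
      ← pow_succ']
  -- By `hVT` the value at `T` is the bounded operator `V (T/2)` applied, up to sign, to the
  -- derivative just estimated. Either `ρ = 1` or `ρ ≤ L ρ^(3/4)`, and the exponent below `1` gives
  -- `ρ ≤ L⁴`.
  have hρle : ρ ≤ ρm := by
    have h1 : M * ‖V T ((R ^ 4) v)‖ ≤ L * ρ ^ (3 / 4 : ℝ) * a := by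
      rw [hVT]
      have := (V (T / 2)).le_of_opNorm_le (hCV _ (by positivity)) (V (T / 2) ((R ^ 3) v))
      calc _ ≤ M * (CV * (4 / T * K * (a * ρ ^ (3 / 4 : ℝ)))) := by
            gcongr; exact this.trans (by gcongr)
        _ = _ := by rw [hL]; ring
    rcases le_total (M * ‖V T ((R ^ 4) v)‖) a with h2 | h2
    · have : ρ = 1 := by rw [hρ, hb, max_eq_left h2, div_self ha0.ne']
      rw [this]; exact hρm0
    · have h3 : ρ ≤ L * ρ ^ (3 / 4 : ℝ) := by
        refine le_of_mul_le_mul_right ?_ ha0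
        calc ρ * a = b := div_mul_cancel₀ _ ha0.ne'
          _ = _ := max_eq_right h2
          _ ≤ _ := h1
      set s := ρ ^ (1 / 4 : ℝ) with hs
      have hs0 : 0 < s := by positivity
      have e4 : s ^ 4 = ρ := by
        rw [hs, ← Real.rpow_natCast, ← Real.rpow_mul hρ0.le]; norm_num
      have e3 : ρ ^ (3 / 4 : ℝ) = s ^ 3 := by
        rw [hs, ← Real.rpow_natCast, ← Real.rpow_mul hρ0.le]; norm_num
      rw [e3] at h3
      have h4 : s ≤ L := by
        have : s * s ^ 3 ≤ L * s ^ 3 := by rw [← pow_succ', e4]; exact h3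
        exact le_of_mul_le_mul_right this (by positivity)
      calc ρ = s ^ 4 := e4.symm
        _ ≤ L ^ 4 := by gcongr
        _ ≤ ρm := by linarith
  have hpow : ∀ r : ℝ, r ≤ 1 → ρ ^ r ≤ ρm := fun r hr =>
    ((Real.rpow_le_rpow_of_exponent_le hρ1 hr).trans_eq (Real.rpow_one _)).trans hρle
  constructor
  · calc _ ≤ 4 / T * K * (a * ρ ^ (3 / 4 : ℝ)) := hd
      _ ≤ max (4 / T) 1 * K * (a * ρm) := by
        gcongr
        · exact le_max_left _ _
        · exact hpow _ (by norm_num)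
      _ = _ := by rw [ha]; ring
  · intro t ht0 htT
    have := key t (by simpa using ht0) (by simpa using htT) (by simpa using hT.le)
    rw [hFeq] at this
    simp only [ofReal_im, ofReal_re, h.group.map_zero, ContinuousLinearMap.id_apply] at this
    calc _ ≤ K * (a * ρ ^ (t / T)) := this
      _ ≤ max (4 / T) 1 * K * (a * ρm) := by
        gcongr
        · exact le_mul_of_one_le_left hK.le (le_max_right _ _)
        · exact hpow _ ((div_le_one hT).2 htT)
      _ = _ := by rw [ha]; ring

end RegularizedSemigroup

end SplittingGroup

/-! ### Removing the regularization. -/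

namespace SplittingGroup

open MeasureTheory Complex

variable {X : Type*} [NormedAddCommGroup X] [NormedSpace ℂ X]

namespace RegularizedSemigroup

variable {U V : ℝ → X →L[ℂ] X} {R : X →L[ℂ] X}

theorem commute_of_mul_eq (h : RegularizedSemigroup U R V) {P Q B : X →L[ℂ] X} (e : R * P = Q)
    (hQ : Commute B Q) (hB : Commute B R) : Commute B P := by
  refine h.cancel_left ?_
  rw [← mul_assoc, ← hB.eq, mul_assoc, e, ← mul_assoc, e, hQ.eq]

/-- The estimate makes `Q R⁻ⁿ` bounded on the dense range of `Rⁿ`, so it extends to some `P` with `P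
Rⁿ = Q`. Commutation and density turn this into `Rⁿ P = Q`. -/
theorem exists_extension [CompleteSpace X] (h : RegularizedSemigroup U R V) {Q : X →L[ℂ] X}
    {n : ℕ} {C : ℝ} (hC : 0 ≤ C) (hQ : Commute Q R) (hb : ∀ v, ‖Q v‖ ≤ C * ‖(R ^ n) v‖) :
    ∃ P : X →L[ℂ] X, R ^ n * P = Q ∧ ‖P‖ ≤ C := by
  have hd : DenseRange (R ^ n : X →L[ℂ] X).toLinearMap := h.denseRange_pow n
  have hb' : ∀ v, ‖Q.toLinearMap v‖ ≤ C * ‖(R ^ n : X →L[ℂ] X).toLinearMap v‖ := hb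
  refine ⟨Q.toLinearMap.extendOfNorm (R ^ n : X →L[ℂ] X).toLinearMap, ?_,
    LinearMap.opNorm_extendOfNorm_le hd hC hb'⟩
  ext x
  refine congrFun (hd.equalizer (by fun_prop) (by fun_prop) (funext fun v => ?_)) x
  have e := LinearMap.extendOfNorm_eq hd ⟨C, hb'⟩ v
  simp only [Function.comp_apply, mul_apply_eq_comp, e]
  exact (DFunLike.congr_fun (hQ.pow_right n).eq v).symm

theorem cancel_left_pow (h : RegularizedSemigroup U R V) (n : ℕ) {P Q : X →L[ℂ] X}
    (e : R ^ n * P = R ^ n * Q) : P = Q := by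
  induction n with
  | zero => simpa using e
  | succ n ih =>
    rw [pow_succ', mul_assoc, mul_assoc] at e
    exact ih (h.cancel_left e)

/-- A regularized semigroup comes from a bounded semigroup that extends holomorphically to the open
right half-plane. -/
theorem exists_semigroup [CompleteSpace X] (h : RegularizedSemigroup U R V) :
    ∃ (T : ℝ → X →L[ℂ] X) (C : ℝ), IsC0Semigroup T ∧ (∀ t, 0 ≤ t → ‖T t‖ ≤ C) ∧
      (∀ t, 0 ≤ t → R * T t = V t) ∧
      DifferentiableOn ℂ (fun z : ℂ => T z.re * U z.im) {z | 0 < z.re} := by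
  obtain ⟨CV, hCV⟩ := h.bounded
  have hCV0 : 0 ≤ CV := (norm_nonneg _).trans (hCV 0 le_rfl)
  obtain ⟨C₁, hC₁, hs⟩ := h.exists_smoothing one_pos
  have hT : ∀ t, ∃ P, 0 ≤ t → R * P = V t ∧ ‖P‖ ≤ max C₁ (CV * C₁) := by
    intro t
    rcases lt_or_ge t 0 with ht | ht
    · exact ⟨0, fun h => absurd h (not_le.2 ht)⟩
    obtain ⟨P, hP, hP'⟩ := h.exists_extension (Q := V t * R ^ 4) (n := 5)
      (C := max C₁ (CV * C₁)) (le_max_of_le_left hC₁)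
      ((h.comm t).mul_left ((Commute.refl R).pow_left 4)) (fun v => by
        rcases le_total t 1 with h1 | h1
        · refine ((hs v).2 t ht h1).trans ?_
          gcongr
          exact le_max_left _ _
        -- For large times only the last half unit of time is used for smoothing, so the bound on `T
        -- t` is uniform in `t`.
        · have e : V t * R ^ 4 = V (t - 1 / 2) * (V (1 / 2) * R ^ 3) := by
            rw [← mul_assoc, h.map_mul _ _ (by linarith) (by norm_num), sub_add_cancel, mul_assoc,
              ← pow_succ']
          rw [e]
          refine ((V (t - 1 / 2)).le_of_opNorm_le (hCV _ (by linarith)) _).trans ?_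
          calc CV * ‖(V (1 / 2) * R ^ 3) v‖ ≤ CV * (C₁ * ‖(R ^ 5) v‖) := by
                gcongr; exact (hs v).1
            _ = CV * C₁ * ‖(R ^ 5) v‖ := by ring
            _ ≤ _ := by gcongr; exact le_max_right _ _)
    refine ⟨P, fun _ => ⟨h.cancel_left_pow 4 ?_, hP'⟩⟩
    rw [← mul_assoc, ← pow_succ, hP, ((h.comm t).pow_right 4).eq]
  choose T hT using hT
  have hRT : ∀ t, 0 ≤ t → R * T t = V t := fun t ht => (hT t ht).1
  have hTb : ∀ t, 0 ≤ t → ‖T t‖ ≤ max C₁ (CV * C₁) := fun t ht => (hT t ht).2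
  have hTR : ∀ t, 0 ≤ t → Commute R (T t) := fun t ht =>
    h.commute_of_mul_eq (hRT t ht) (h.comm t).symm (Commute.refl R)
  have hUT : ∀ s t, 0 ≤ t → Commute (U s) (T t) := fun s t ht =>
    h.commute_of_mul_eq (hRT t ht) (h.group_comm' s t) (h.group_comm s)
  have hadd : ∀ s t, 0 ≤ s → 0 ≤ t → T (s + t) = T s * T t := fun s t hs ht => by
    refine h.cancel_left (h.cancel_left ?_)
    rw [hRT _ (add_nonneg hs ht), ← (h.comm _).eq, ← h.map_mul s t hs ht, ← hRT s hs, ← hRT t ht,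
      mul_assoc, ← mul_assoc (T s), ← (hTR s hs).eq]
    simp only [mul_assoc]
  have hsc : ∀ x, ContinuousOn (fun t => T t x) (Ici 0) := by
    intro x
    set C := max C₁ (CV * C₁)
    have hC0 : 0 ≤ C := le_max_of_le_left hC₁
    refine continuousOn_of_uniform_approx_of_continuousOn fun u hu => ?_
    obtain ⟨ε, hε, hu⟩ := Metric.mem_uniformity_dist.1 hu
    obtain ⟨v, hv⟩ := Metric.denseRange_iff.1 h.denseRange x (ε / (C + 1)) (by positivity)
    refine ⟨fun t => V t v, h.strong_cont v, fun t ht => hu ?_⟩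
    have e : V t v = T t (R v) := by
      rw [← hRT t ht, (hTR t ht).eq]; rfl
    change dist (T t x) (V t v) < ε
    rw [e, dist_eq_norm, ← map_sub]
    rw [dist_eq_norm, lt_div_iff₀ (by positivity)] at hv
    refine ((T t).le_of_opNorm_le (hTb t ht) _).trans_lt ?_
    nlinarith [norm_nonneg (x - R v)]
  refine ⟨T, _, ⟨?_, hadd, hsc⟩, hTb, hRT, ?_⟩
  · refine h.cancel_left ?_
    rw [hRT 0 le_rfl, h.map_zero]; rfl
  · intro z hz
    have hz : 0 < z.re := hz
    -- The operator `D` below is `exp(tA) R⁻¹`, so `T (5t) = D⁵ R⁵`. Near `z` the family is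
    -- therefore `D⁵` times the holomorphic `orbit` at `w - 5t`; the choice `5t = Re z / 2` keeps
    -- that point in the right half-plane.
    set t := z.re / 10 with ht
    have ht0 : 0 < t := by positivity
    obtain ⟨C₂, hC₂, hs₂⟩ := h.exists_smoothing (T := 2 * t) (by positivity)
    obtain ⟨D, hD, -⟩ := h.exists_extension (Q := V t * R ^ 3) (n := 5) hC₂
      ((h.comm t).mul_left ((Commute.refl R).pow_left 3)) (fun v => by
        have := (hs₂ v).1
        rw [mul_div_cancel_left₀ _ two_ne_zero] at this
        exact this)
    have hD2 : R * (R * D) = V t := by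
      refine h.cancel_left_pow 3 ?_
      rw [← ((h.comm t).pow_right 3).eq, ← hD]
      simp only [pow_succ, pow_zero, one_mul, mul_assoc]
    have hRD : R * D = T t := h.cancel_left (by rw [hD2, hRT t ht0.le])
    have hDR : Commute R D := h.commute_of_mul_eq hRD (hTR t ht0.le) (Commute.refl R)
    have hD5 : D ^ 5 * R ^ 5 = T (5 * t) := by
      rw [← hDR.symm.mul_pow, ← hDR.eq, hRD]
      have e : 5 * t = t + (t + (t + (t + t))) := by ring
      rw [e, hadd _ _ ht0.le (by positivity), hadd _ _ ht0.le (by positivity),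
        hadd _ _ ht0.le (by positivity), hadd _ _ ht0.le (by positivity)]
      simp only [pow_succ, pow_zero, one_mul, mul_assoc]
    have hz' : 0 < (z - (5 * t : ℝ)).re := by
      rw [sub_re, ofReal_re, ht]; linarith
    have hd := ((h.hasDerivAt_orbit hz').comp_sub_const z _).const_mul (D ^ 5)
    refine (hd.differentiableAt.congr_of_eventuallyEq ?_).differentiableWithinAt
    have hopen : ∀ᶠ w : ℂ in 𝓝 z, 5 * t < w.re :=
      continuous_re.continuousAt.eventually (lt_mem_nhds (by rw [ht]; linarith))
    filter_upwards [hopen] with w hw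
    have hw' : 0 ≤ w.re - 5 * t := by linarith
    have e1 : w.re = 5 * t + (w.re - 5 * t) := by ring
    have e2 : T w.re = T (5 * t) * T (w.re - 5 * t) := by
      rw [← hadd _ _ (by positivity) hw', ← e1]
    rw [e2, ← hD5, h.orbit_eq, sub_re, sub_im, ofReal_re, ofReal_im, sub_zero, ← hRT _ hw',
      mul_assoc, mul_assoc, (hUT w.im _ hw').symm.eq]
    congr 1
    rw [mul_assoc R, ← ((hTR _ hw').pow_left 4).eq, ← mul_assoc R, ← pow_succ', ← mul_assoc,
      ← ((h.group_comm w.im).pow_right 5).eq, mul_assoc]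

end RegularizedSemigroup

end SplittingGroup

/-! ### The generator of the recovered semigroup, and bounds on sectors. -/

namespace SplittingGroup

open MeasureTheory Complex

variable {X : Type*} [NormedAddCommGroup X] [NormedSpace ℂ X]

theorem tendsto_quotient_exp_smul {T : ℝ → X →L[ℂ] X} {x y : X} (ω : ℝ)
    (h : Tendsto (fun h : ℝ => (h : ℂ)⁻¹ • (T h x - x)) (𝓝[>] 0) (𝓝 y)) :
    Tendsto (fun h : ℝ => (h : ℂ)⁻¹ • ((exp (-ω * h) • T h) x - x)) (𝓝[>] 0)
      (𝓝 (y - (ω : ℂ) • x)) := by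
  have h1 : Tendsto (fun h : ℝ => h⁻¹ • (exp (-ω * h) - 1)) (𝓝[>] 0) (𝓝 (-ω : ℂ)) := by
    have : HasDerivAt (fun h : ℝ => exp (-ω * h)) (-ω : ℂ) 0 := by
      have := ((ofRealCLM.hasDerivAt (x := 0)).const_mul (-ω : ℂ)).cexp
      simpa using this
    have := this.tendsto_slope_zero_right
    simpa using this
  have h2 : Tendsto (fun h : ℝ => exp (-ω * h)) (𝓝[>] 0) (𝓝 1) := by
    have : Continuous (fun h : ℝ => exp (-ω * h)) := by fun_prop
    have := this.tendsto 0
    simp only [ofReal_zero, mul_zero, exp_zero] at this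
    exact this.mono_left nhdsWithin_le_nhds
  have h3 := (h2.smul h).add (h1.smul_const x)
  rw [one_smul, neg_smul, ← sub_eq_add_neg] at h3
  refine h3.congr fun s => ?_
  rw [smul_apply, ofReal_inv_smul, ofReal_inv_smul, smul_assoc, sub_smul, one_smul,
    smul_comm (exp _) s⁻¹, ← smul_add]
  congr 1
  rw [smul_sub]; abel

theorem IsSemigroupGenerator.shift {T : ℝ → X →L[ℂ] X} {A : X →ₗ.[ℂ] X}
    (hA : IsSemigroupGenerator T A) (ω : ℝ) :
    IsSemigroupGenerator (fun t => exp (-ω * t) • T t) (shift A ω) := by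
  intro x y
  rw [mem_graph_shift, hA]
  constructor
  · intro h
    simpa using tendsto_quotient_exp_smul ω h
  · intro h
    have := tendsto_quotient_exp_smul (T := fun t => exp (-ω * t) • T t) (-ω) h
    simpa [smul_smul, ← exp_add] using this

theorem IsC0Semigroup.exp_smul {T : ℝ → X →L[ℂ] X} (hT : IsC0Semigroup T) (ω : ℝ) :
    IsC0Semigroup (fun t => exp (-ω * t) • T t) := by
  refine ⟨by simp [hT.map_zero], fun s t hs ht => ?_, fun x => ?_⟩
  · rw [hT.map_add s t hs ht, ContinuousLinearMap.smul_comp, ContinuousLinearMap.comp_smul,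
      smul_smul, ← exp_add]
    congr 2
    push_cast; ring
  · exact ContinuousOn.smul (by fun_prop) (hT.strong_cont x)

theorem re_pos_of_mem_sector {φ : ℝ} (hφ : φ ≤ Real.pi / 2) {z : ℂ} (hz : z ∈ sector φ) :
    0 < z.re := by
  have := abs_arg_lt_pi_div_two_iff.1 (hz.2.trans_le hφ)
  exact this.resolve_right hz.1

theorem abs_im_le_of_mem_sector {φ : ℝ} (hφ : φ < Real.pi / 2) {z : ℂ} (hz : z ∈ sector φ) :
    |z.im| ≤ Real.tan φ * z.re := by
  have hre := re_pos_of_mem_sector hφ.le hz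
  obtain ⟨h1, h2⟩ := abs_lt.1 hz.2
  have hpi := Real.pi_pos
  have hmono := Real.strictMonoOn_tan.monotoneOn
  have h3 := hmono ⟨by linarith, by linarith⟩ ⟨by linarith, hφ⟩ h2.le
  have h4 := hmono (a := -φ) ⟨by linarith, by linarith⟩ ⟨by linarith, by linarith⟩ h1.le
  rw [Real.tan_neg] at h4
  rw [tan_arg] at h3 h4
  rw [abs_le]
  constructor
  · have := (le_div_iff₀ hre).1 h4
    linarith
  · exact (div_le_iff₀ hre).1 h3

namespace RegularizedSemigroup

variable {U V : ℝ → X →L[ℂ] X} {R : X →L[ℂ] X}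

theorem integral_eq [CompleteSpace X] (h : RegularizedSemigroup U R V) (x : X) {t : ℝ}
    (ht : 0 ≤ t) : ∫ s in (0 : ℝ)..t, V s x = -(V t (R x) - R (R x)) := by
  have hc : ContinuousOn (fun s => (-1 : ℂ) • V s x) (Icc 0 t) :=
    ((h.strong_cont x).mono Icc_subset_Ici_self).const_smul _
  have h1 := intervalIntegral.integral_eq_sub_of_hasDerivAt_of_le ht
    ((h.strong_cont (R x)).mono Icc_subset_Ici_self) (fun s hs => h.hasDerivAt x s hs.1)
    (hc.intervalIntegrable_of_Icc ht)
  rw [intervalIntegral.integral_smul, h.map_zero] at h1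
  rw [← h1]; simp

/-- The known derivative formula concerns `V = R T` after a further `R`. Difference quotients of `T`
are therefore compared after applying `R` (or `R²` for the converse), and injectivity of `R` removes
it again. -/
theorem isSemigroupGenerator [CompleteSpace X] (h : RegularizedSemigroup U R V)
    {A : X →ₗ.[ℂ] X} (hA : IsResolvent A 0 R) {T : ℝ → X →L[ℂ] X} (hT : IsC0Semigroup T)
    (hRT : ∀ t, 0 ≤ t → R * T t = V t) : IsSemigroupGenerator T A := by
  have hRT' : ∀ t, 0 ≤ t → ∀ x, R (T t x) = V t x := fun t ht x =>
    DFunLike.congr_fun (hRT t ht) x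
  have hVR : ∀ t x, V t (R x) = R (V t x) := fun t x => DFunLike.congr_fun (h.comm t).eq x
  intro x y
  rw [hA.mem_graph_iff]
  constructor
  · rintro rfl
    have h1 := tendsto_average (hT.strong_cont y)
    rw [hT.map_zero] at h1
    refine h1.congr' ?_
    filter_upwards [self_mem_nhdsWithin] with t ht
    have ht : 0 < t := ht
    congr 1
    apply h.injective
    have hi : IntervalIntegrable (fun s => T s y) volume 0 t :=
      ((hT.strong_cont y).mono Icc_subset_Ici_self).intervalIntegrable_of_Icc ht.le
    rw [← ContinuousLinearMap.intervalIntegral_comp_comm R hi, map_sub, hRT' t ht.le, map_neg,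
      map_neg, sub_neg_eq_add]
    have : ∫ s in (0 : ℝ)..t, R (T s y) = ∫ s in (0 : ℝ)..t, V s y := by
      refine intervalIntegral.integral_congr fun s hs => ?_
      rw [uIcc_of_le ht.le] at hs
      exact hRT' s hs.1 y
    rw [this, h.integral_eq y ht.le]
    abel
  · intro hlim
    have h1 := ((R * R).continuous.tendsto y).comp hlim
    have h2 := (tendsto_average (h.strong_cont x)).neg
    rw [h.map_zero] at h2
    have h3 : -R x = R (R y) := by
      refine tendsto_nhds_unique (h2.congr' ?_) h1
      filter_upwards [self_mem_nhdsWithin] with t ht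
      have ht : 0 < t := ht
      simp only [Function.comp_apply, map_smul, map_sub, mul_apply_eq_comp]
      rw [h.integral_eq x ht.le, hRT' t ht.le, hVR, smul_neg, neg_neg]
    rw [← map_neg] at h3
    rw [← h.injective h3, neg_neg]

theorem generatesHolomorphic [CompleteSpace X] (h : RegularizedSemigroup U R V)
    {A : X →ₗ.[ℂ] X} (hA : IsResolvent A 0 R) :
    GeneratesHolomorphic A (Real.pi / 2) ∧ ∀ μ : ℂ, 0 < μ.re → μ ∈ resolventSet A := by
  obtain ⟨T, C, hT, hTC, hRT, hd⟩ := h.exists_semigroup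
  have hgen := h.isSemigroupGenerator hA hT hRT
  constructor
  · intro θ hθ hθ'
    obtain ⟨M, ω₀, hM, hω₀, hU⟩ := h.group.exists_bound
    have htan : 0 ≤ Real.tan θ := Real.tan_nonneg_of_nonneg_of_le_pi_div_two hθ.le hθ'.le
    -- In the sector of angle `θ` one has `|Im z| ≤ tan θ · Re z`, so this shift absorbs the growth
    -- `exp (ω₀ |Im z|)` of the group.
    refine ⟨ω₀ * Real.tan θ, by positivity, _, hT.exp_smul _, hgen.shift _, ?_⟩
    refine ⟨fun z => exp (-(ω₀ * Real.tan θ : ℝ) * z) • (T z.re * U z.im), ?_, ?_, ?_⟩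
    · intro t ht
      simp only [ofReal_re, ofReal_im, h.group.map_zero]
      rfl
    · have he : Differentiable ℂ fun z : ℂ => exp (-(ω₀ * Real.tan θ : ℝ) * z) := by fun_prop
      refine he.differentiableOn.smul (hd.mono fun z hz => ?_)
      exact re_pos_of_mem_sector hθ'.le hz
    · intro φ hφ hφθ
      refine ⟨C * M, fun z hz => ?_⟩
      have hz' : z ∈ sector θ := ⟨hz.1, hz.2.trans hφθ⟩
      have hre := re_pos_of_mem_sector hθ'.le hz'
      have him := abs_im_le_of_mem_sector hθ' hz'
      rw [norm_smul, norm_exp]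
      have e : (-((ω₀ * Real.tan θ : ℝ) : ℂ) * z).re = -(ω₀ * Real.tan θ * z.re) := by
        rw [← ofReal_neg, re_ofReal_mul]; ring
      rw [e]
      have hC0 : 0 ≤ C := (norm_nonneg _).trans (hTC 0 le_rfl)
      calc _ ≤ Real.exp (-(ω₀ * Real.tan θ * z.re)) * (C * (M * Real.exp (ω₀ * |z.im|))) := by
            gcongr
            refine (norm_mul_le _ _).trans ?_
            gcongr
            · exact hTC _ hre.le
            · exact hU _
        _ = C * M * (Real.exp (-(ω₀ * Real.tan θ * z.re) + ω₀ * |z.im|)) := by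
            rw [Real.exp_add]; ring
        _ ≤ C * M * 1 := by
            gcongr
            rw [Real.exp_le_one_iff]
            have := mul_le_mul_of_nonneg_left him hω₀
            linarith
        _ = _ := mul_one _
  · intro μ hμ
    obtain ⟨P, hP, -⟩ := hT.exists_isResolvent hgen (M := C) (ω := 0)
      (fun t ht => by simpa using hTC t ht) hμ
    exact mem_resolventSet_iff.2 ⟨P, hP⟩

end RegularizedSemigroup

end SplittingGroup

/-! ### Generators of groups, and decay of the resolvent in the strip. -/

namespace SplittingGroup

open MeasureTheory Complex

variable {E : Type*} [NormedAddCommGroup E] [NormedSpace ℂ E]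

section Group

variable {U : ℝ → E →L[ℂ] E} {B : E →ₗ.[ℂ] E}

theorem IsC0Group.tendsto_apply [CompleteSpace E] (hU : IsC0Group U) {ι : Type*} {l : Filter ι}
    {τ : ι → ℝ} {g : ι → E} {y : E} (hτ : Tendsto τ l (𝓝 0)) (hg : Tendsto g l (𝓝 y)) :
    Tendsto (fun i => U (τ i) (g i)) l (𝓝 y) := by
  obtain ⟨M, ω, hM, hω, hb⟩ := hU.exists_bound
  have h1 : Tendsto (fun i => U (τ i) (g i - y)) l (𝓝 0) := by
    have h2 : Tendsto (fun i => M * Real.exp (ω * |τ i|) * ‖g i - y‖) l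
        (𝓝 (M * Real.exp (ω * |0|) * 0)) := by
      refine Tendsto.mul ?_ (tendsto_iff_norm_sub_tendsto_zero.1 hg)
      have : Continuous fun t : ℝ => M * Real.exp (ω * |t|) := by fun_prop
      exact (this.tendsto 0).comp hτ
    rw [mul_zero] at h2
    exact squeeze_zero_norm (fun i => (U (τ i)).le_of_opNorm_le (hb _) _) h2
  have h3 : Tendsto (fun i => U (τ i) y) l (𝓝 y) := by
    have := ((hU.strong_cont y).tendsto 0).comp hτ
    rwa [hU.map_zero] at this
  simpa using h1.add h3

/-- For `t < 0` the difference quotient at `t` is `U t` applied to the one at `-t`, so the one-sided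
limit already gives the two-sided one. -/
theorem IsGroupGenerator.isSemigroupGenerator [CompleteSpace E] (hU : IsC0Group U)
    (hB : IsGroupGenerator U B) : IsSemigroupGenerator U B := by
  intro x y
  rw [hB]
  constructor
  · intro h
    exact h.mono_left (nhdsWithin_mono _ fun t (ht : 0 < t) => ht.ne')
  · intro h
    rw [← nhdsLT_sup_nhdsGT, tendsto_sup]
    refine ⟨?_, h⟩
    have hneg : Tendsto (fun t : ℝ => -t) (𝓝[<] 0) (𝓝[>] 0) := by
      have := tendsto_neg_nhdsLT (a := (0 : ℝ))
      rwa [neg_zero] at this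
    have h1 := hU.tendsto_apply (tendsto_nhdsWithin_of_tendsto_nhds tendsto_id) (h.comp hneg)
    refine h1.congr fun t => ?_
    have h2 := hU.reverse.inv_mul t x
    simp only [neg_neg] at h2
    simp only [id_eq, Function.comp_apply, map_smul, map_sub, h2]
    push_cast
    rw [inv_neg, neg_smul, ← smul_neg, neg_sub]

theorem IsGroupGenerator.reverse (hB : IsGroupGenerator U B) :
    IsGroupGenerator (fun t => U (-t)) (-B) := by
  have hneg : Tendsto (fun t : ℝ => -t) (𝓝[≠] 0) (𝓝[≠] 0) := by
    refine tendsto_nhdsWithin_iff.2 ⟨?_, ?_⟩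
    · have : Tendsto (fun t : ℝ => -t) (𝓝 0) (𝓝 (-0)) := continuous_neg.tendsto 0
      rw [neg_zero] at this
      exact this.mono_left nhdsWithin_le_nhds
    · filter_upwards [self_mem_nhdsWithin] with t ht
      simpa using ht
  intro x y
  rw [mem_graph_neg, hB]
  constructor
  · intro h
    have := (h.comp hneg).neg
    rw [neg_neg] at this
    refine this.congr fun t => ?_
    simp
  · intro h
    have := (h.comp hneg).neg
    refine this.congr fun t => ?_
    simp

theorem IsGroupGenerator.map_mem_graph (hU : IsC0Group U) (hB : IsGroupGenerator U B) (s : ℝ)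
    {x y : E} (h : (x, y) ∈ B.graph) : (U s x, U s y) ∈ B.graph := by
  rw [hB] at h ⊢
  refine (((U s).continuous.tendsto y).comp h).congr fun t => ?_
  simp only [Function.comp_apply, map_smul, map_sub, ← ContinuousLinearMap.comp_apply,
    ← hU.map_add]
  rw [add_comm s t]

theorem IsGroupGenerator.hasDerivAt (hU : IsC0Group U) (hB : IsGroupGenerator U B)
    {x y : E} (h : (x, y) ∈ B.graph) (t : ℝ) : HasDerivAt (fun s => U s x) (U t y) t := by
  rw [hasDerivAt_iff_tendsto_slope_zero]
  rw [hB] at h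
  refine (((U t).continuous.tendsto y).comp h).congr fun s => ?_
  rw [Function.comp_apply, map_smul, map_sub, hU.map_add, ContinuousLinearMap.comp_apply,
    ofReal_inv_smul]

theorem IsResolvent.of_smul {A : E →ₗ.[ℂ] E} {a μ : ℂ} (ha : a ≠ 0) {R : E →L[ℂ] E}
    (hR : IsResolvent (a • A) μ R) : IsResolvent A (a⁻¹ * μ) (a • R) := by
  refine ⟨fun x y h => ?_, fun y => ?_⟩
  · have := hR.left_inv x (a • y) ((mem_graph_smul ha).2 (by rwa [inv_smul_smul₀ ha]))
    rw [smul_apply, ← map_smul, smul_sub, smul_smul, mul_inv_cancel_left₀ ha, this]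
  · have := (mem_graph_smul ha).1 (hR.mem_graph y)
    have := A.graph.smul_mem a this
    convert this using 1
    simp only [smul_apply, Prod.smul_mk, smul_smul, smul_sub, mul_inv_cancel₀ ha, one_smul]
    congr 3
    field_simp

/-- Since `Re (iw) = -Im w`, such `w` correspond to points right of the growth bound of the
semigroup generated by `iA`. The upper half-plane follows from the reversed group, generated by
`i(-A)`. -/
theorem exists_isResolvent_of_im_lt [CompleteSpace E] (hU : IsC0Group U) {A : E →ₗ.[ℂ] E}
    (hA : IsGroupGenerator U (I • A)) {M ω : ℝ} (hω : 0 ≤ ω)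
    (hM : ∀ t, ‖U t‖ ≤ M * Real.exp (ω * |t|))
    {w : ℂ} (hw : w.im < -ω) : ∃ R, IsResolvent A w R ∧ ‖R‖ ≤ M / (|w.im| - ω) := by
  have hM0 : 0 ≤ M := by
    have := (norm_nonneg _).trans (hM 0)
    simpa using this
  obtain ⟨R, hR, hRn⟩ := hU.isC0Semigroup.exists_isResolvent (hA.isSemigroupGenerator hU)
    (M := M) (ω := ω) (fun t ht => by simpa [abs_of_nonneg ht] using hM t) (μ := I * w)
    (by simp; linarith)
  have h1 := hR.of_smul I_ne_zero
  rw [inv_mul_cancel_left₀ I_ne_zero] at h1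
  refine ⟨_, h1, ?_⟩
  rw [norm_smul, norm_I, one_mul]
  refine hRn.trans ?_
  have h2 : (I * w).re = -w.im := by simp
  rw [h2, ← abs_of_neg (by linarith : w.im < 0)]

theorem neg_smul_comm (A : E →ₗ.[ℂ] E) : -(I • A) = I • (-A) := by
  refine LinearPMap.eq_of_eq_graph (Submodule.ext fun ⟨x, y⟩ => ?_)
  rw [mem_graph_neg, mem_graph_smul I_ne_zero, mem_graph_smul I_ne_zero, mem_graph_neg, smul_neg]

theorem exists_isResolvent_of_abs_im [CompleteSpace E] (hU : IsC0Group U) {A : E →ₗ.[ℂ] E}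
    (hA : IsGroupGenerator U (I • A)) {M ω : ℝ} (hω : 0 ≤ ω)
    (hM : ∀ t, ‖U t‖ ≤ M * Real.exp (ω * |t|))
    {w : ℂ} (hw : ω < |w.im|) : ∃ R, IsResolvent A w R ∧ ‖R‖ ≤ M / (|w.im| - ω) := by
  rcases lt_abs.1 hw with h | h
  · have hA' := hA.reverse
    rw [neg_smul_comm] at hA'
    obtain ⟨R, hR, hRn⟩ := exists_isResolvent_of_im_lt hU.reverse hA' hω (M := M) (ω := ω)
      (fun t => by simpa using hM (-t)) (w := -w) (by simpa using h)
    have := hR.neg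
    rw [neg_neg, neg_neg] at this
    exact ⟨_, this, by simpa using hRn⟩
  · exact exists_isResolvent_of_im_lt hU hA hω hM (by linarith)

end Group

/-- `R` is the resolvent of `A` on the closed strip `|Re w| ≤ δ`, with decay at infinity. -/
structure IsStripResolvent (A : E →ₗ.[ℂ] E) (δ : ℝ) (R : ℂ → E →L[ℂ] E) : Prop where
  pos : 0 < δ
  isResolvent : ∀ w : ℂ, |w.re| ≤ δ → IsResolvent A w (R w)
  decay : ∃ K, ∀ w : ℂ, |w.re| ≤ δ → ‖w‖ * ‖R w‖ ≤ K

namespace IsStripResolvent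

variable {A : E →ₗ.[ℂ] E} {δ : ℝ} {R : ℂ → E →L[ℂ] E}

theorem neg (h : IsStripResolvent A δ R) : IsStripResolvent (-A) δ (fun w => -R (-w)) := by
  refine ⟨h.pos, fun w hw => ?_, ?_⟩
  · have := (h.isResolvent (-w) (by simpa using hw)).neg
    rwa [neg_neg] at this
  · obtain ⟨K, hK⟩ := h.decay
    exact ⟨K, fun w hw => by simpa using hK (-w) (by simpa using hw)⟩

end IsStripResolvent

/-- In `R = R₀ + (w₀ - w) R R₀` the last term is at most `‖R‖ / 2` and can be absorbed. This local
bound turns the resolvent identity into continuity and differentiability of the resolvent. -/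
theorem norm_le_of_isResolvent {A : E →ₗ.[ℂ] E} {w w₀ : ℂ} {R R₀ : E →L[ℂ] E}
    (hR : IsResolvent A w R) (hR₀ : IsResolvent A w₀ R₀) (h : ‖w - w₀‖ * ‖R₀‖ ≤ 1 / 2) :
    ‖R‖ ≤ 2 * ‖R₀‖ := by
  have h1 : R = R₀ + (w₀ - w) • (R * R₀) := by rw [← hR.sub_eq hR₀]; abel
  have h2 : ‖R‖ ≤ ‖R₀‖ + ‖w - w₀‖ * (‖R‖ * ‖R₀‖) := by
    calc ‖R‖ = ‖R₀ + (w₀ - w) • (R * R₀)‖ := by rw [← h1]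
      _ ≤ ‖R₀‖ + ‖(w₀ - w) • (R * R₀)‖ := norm_add_le _ _
      _ ≤ _ := by
        rw [norm_smul, norm_sub_rev]
        gcongr
        exact norm_mul_le _ _
  nlinarith [norm_nonneg R]

theorem continuousOn_resolvent {A : E →ₗ.[ℂ] E} {s : Set ℂ} {R : ℂ → E →L[ℂ] E}
    (hR : ∀ w ∈ s, IsResolvent A w (R w)) : ContinuousOn R s := by
  intro w₀ hw₀
  have hlim : Tendsto (fun w => ‖w - w₀‖) (𝓝[s] w₀) (𝓝 0) := by
    have : Continuous fun w : ℂ => ‖w - w₀‖ := by fun_prop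
    have := this.tendsto w₀
    rw [sub_self, norm_zero] at this
    exact this.mono_left nhdsWithin_le_nhds
  have hev : ∀ᶠ w in 𝓝[s] w₀, ‖w - w₀‖ * ‖R w₀‖ ≤ 1 / 2 := by
    have := hlim.mul_const ‖R w₀‖
    rw [zero_mul] at this
    exact (this.eventually (gt_mem_nhds (by norm_num : (0 : ℝ) < 1 / 2))).mono fun w hw => hw.le
  refine tendsto_iff_norm_sub_tendsto_zero.2 ?_
  have h0 := hlim.mul_const (2 * ‖R w₀‖ * ‖R w₀‖)
  rw [zero_mul] at h0
  refine squeeze_zero' (Eventually.of_forall fun _ => norm_nonneg _) ?_ h0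
  filter_upwards [hev, self_mem_nhdsWithin] with w hw hws
  rw [(hR w hws).sub_eq (hR w₀ hw₀), norm_smul, norm_sub_rev]
  gcongr
  refine (norm_mul_le _ _).trans ?_
  gcongr
  exact norm_le_of_isResolvent (hR w hws) (hR w₀ hw₀) hw

theorem hasDerivAt_resolvent {A : E →ₗ.[ℂ] E} {s : Set ℂ} {R : ℂ → E →L[ℂ] E}
    (hR : ∀ w ∈ s, IsResolvent A w (R w)) {w₀ : ℂ} (hs : s ∈ 𝓝 w₀) :
    HasDerivAt R (-(R w₀ * R w₀)) w₀ := by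
  have hc := (continuousOn_resolvent hR).continuousAt hs
  rw [hasDerivAt_iff_tendsto_slope]
  have h1 : Tendsto (fun w => -(R w * R w₀)) (𝓝[≠] w₀) (𝓝 (-(R w₀ * R w₀))) :=
    ((hc.tendsto.mul_const _).neg).mono_left nhdsWithin_le_nhds
  refine h1.congr' ?_
  filter_upwards [self_mem_nhdsWithin, nhdsWithin_le_nhds hs] with w hw hws
  have hne : w - w₀ ≠ 0 := sub_ne_zero.2 hw
  rw [slope_def_module, (hR w hws).sub_eq (hR w₀ (mem_of_mem_nhds hs)), smul_smul,
    ← neg_sub w w₀, mul_neg, inv_mul_cancel₀ hne, neg_smul, one_smul]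

theorem exists_isStripResolvent [CompleteSpace E] {U : ℝ → E →L[ℂ] E} (hU : IsC0Group U)
    {A : E →ₗ.[ℂ] E} (hA : IsGroupGenerator U (I • A)) {δ : ℝ} (hδ : 0 < δ)
    (hs : ∀ w : ℂ, |w.re| ≤ δ → w ∈ resolventSet A) : ∃ R, IsStripResolvent A δ R := by
  have hs' : ∀ w : ℂ, ∃ R, |w.re| ≤ δ → IsResolvent A w R := fun w => by
    by_cases h : |w.re| ≤ δ
    · obtain ⟨R, hR⟩ := mem_resolventSet_iff.1 (hs w h)
      exact ⟨R, fun _ => hR⟩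
    · exact ⟨0, fun h' => absurd h' h⟩
  choose R hR using hs'
  refine ⟨R, hδ, hR, ?_⟩
  obtain ⟨M, ω, hM, hω, hb⟩ := hU.exists_bound
  have hcont : ContinuousOn R {w | |w.re| ≤ δ} := continuousOn_resolvent fun w hw => hR w hw
  -- Continuity gives the bound on the rectangle `|Im w| ≤ ω + 1`. Above and below it, `|Im w| - ω >
  -- 1`, so the Laplace bound `M / (|Im w| - ω)` is comparable to `1 / ‖w‖` in the strip.
  have hcomp : IsCompact (Icc (-δ) δ ×ℂ Icc (-(ω + 1)) (ω + 1)) := isCompact_Icc.reProdIm isCompact_Icc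
  obtain ⟨K, hK⟩ := hcomp.exists_bound_of_continuousOn (f := fun w => w • R w)
    (continuousOn_id.smul (hcont.mono fun w hw => abs_le.2 hw.1))
  refine ⟨max K ((δ + ω + 1) * M), fun w hw => ?_⟩
  rcases le_or_gt |w.im| (ω + 1) with h | h
  · have := hK w ⟨abs_le.1 hw, abs_le.1 h⟩
    rw [norm_smul] at this
    exact this.trans (le_max_left _ _)
  · obtain ⟨R', hR', hn⟩ := exists_isResolvent_of_abs_im hU hA hω hb (w := w) (by linarith)
    rw [← (hR w hw).unique hR'] at hn
    refine le_trans ?_ (le_max_right _ _)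
    have h1 : 0 < |w.im| - ω := by linarith
    have h2 : ‖w‖ ≤ (δ + ω + 1) * (|w.im| - ω) := by
      refine (norm_le_abs_re_add_abs_im w).trans ?_
      nlinarith
    calc ‖w‖ * ‖R w‖ ≤ (δ + ω + 1) * (|w.im| - ω) * (M / (|w.im| - ω)) := by gcongr
      _ = _ := by field_simp

end SplittingGroup

/-! ### Integrals along vertical lines. -/

namespace SplittingGroup

open MeasureTheory Complex

section Vertical

variable {F : Type*} [NormedAddCommGroup F] [NormedSpace ℂ F]

theorem normSq_line (d y : ℝ) : ‖(d + y * I : ℂ)‖ ^ 2 = d ^ 2 + y ^ 2 := by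
  rw [← normSq_eq_norm_sq, normSq_add_mul_I]

theorem line_ne_zero {d : ℝ} (hd : d ≠ 0) (y : ℝ) : (d + y * I : ℂ) ≠ 0 := by
  intro h
  exact hd (by simpa using congrArg re h)

theorem inv_sq_add_sq_eq {d : ℝ} (hd : d ≠ 0) (y : ℝ) :
    (d ^ 2 + y ^ 2)⁻¹ = (d ^ 2)⁻¹ * (1 + (y / d) ^ 2)⁻¹ := by
  rw [← mul_inv]
  congr 1
  field_simp

theorem integrable_inv_sq_add_sq {d : ℝ} (hd : d ≠ 0) :
    Integrable fun y : ℝ => (d ^ 2 + y ^ 2)⁻¹ := by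
  simp_rw [inv_sq_add_sq_eq hd]
  exact (integrable_inv_one_add_sq.comp_div hd).const_mul _

theorem integral_inv_sq_add_sq {d : ℝ} (hd : 0 < d) :
    ∫ y : ℝ, (d ^ 2 + y ^ 2)⁻¹ = Real.pi / d := by
  simp_rw [inv_sq_add_sq_eq hd.ne']
  rw [integral_const_mul, Measure.integral_comp_div (fun y : ℝ => (1 + y ^ 2)⁻¹) d,
    integral_univ_inv_one_add_sq, abs_of_pos hd, smul_eq_mul]
  field_simp

/-- Shifting a vertical line of integration across a strip in which the integrand is holomorphic and
decays at infinity. -/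
theorem tendsto_vertical_shift [CompleteSpace F] {f : ℂ → F} {a b C : ℝ} (hab : a ≤ b)
    (hc : ContinuousOn f {z | a ≤ z.re ∧ z.re ≤ b})
    (hd : DifferentiableOn ℂ f {z | a < z.re ∧ z.re < b})
    (hC : ∀ z : ℂ, a ≤ z.re → z.re ≤ b → |z.im| * ‖f z‖ ≤ C) :
    Tendsto (fun Y : ℝ => (∫ y in -Y..Y, f (b + y * I)) - ∫ y in -Y..Y, f (a + y * I))
      atTop (𝓝 0) := by
  have hlim : Tendsto (fun Y : ℝ => 2 * C * (b - a) * Y⁻¹) atTop (𝓝 0) := by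
    simpa using tendsto_inv_atTop_zero.const_mul (2 * C * (b - a))
  refine squeeze_zero_norm' ?_ hlim
  filter_upwards [eventually_gt_atTop 0] with Y hY
  have hrect := integral_boundary_rect_eq_zero_of_continuousOn_of_differentiableOn f
    (a + (-Y : ℝ) * I) (b + Y * I) (hc.mono ?_) (hd.mono ?_)
  · simp only [add_re, ofReal_re, mul_re, I_re, mul_zero, ofReal_im, I_im, mul_one, sub_self,
      add_zero, add_im, mul_im, zero_add] at hrect
    have hI : ∀ v : F, ‖v‖ = ‖I • v‖ := fun v => by rw [norm_smul, norm_I, one_mul]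
    rw [hI, smul_sub]
    have e : I • (∫ y in -Y..Y, f (b + y * I)) - I • ∫ y in -Y..Y, f (a + y * I) =
        (∫ x in a..b, f (x + Y * I)) - ∫ x in a..b, f (x + (-Y : ℝ) * I) := by
      rw [← sub_eq_zero, ← hrect]; abel
    rw [e]
    have hb : ∀ s : ℝ, |s| = Y → ‖∫ x in a..b, f (x + s * I)‖ ≤ C * Y⁻¹ * (b - a) := by
      intro s hs
      rw [← abs_of_nonneg (sub_nonneg.2 hab)]
      refine intervalIntegral.norm_integral_le_of_norm_le_const fun x hx => ?_
      rw [uIoc_of_le hab] at hx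
      have := hC (x + s * I) (by simpa using hx.1.le) (by simpa using hx.2)
      rw [← div_eq_mul_inv, le_div_iff₀ hY, mul_comm]
      simpa [hs] using this
    refine (norm_sub_le _ _).trans ?_
    have h1 := hb Y (abs_of_pos hY)
    have h2 := hb (-Y) (by rw [abs_neg, abs_of_pos hY])
    calc _ ≤ C * Y⁻¹ * (b - a) + C * Y⁻¹ * (b - a) := add_le_add h1 h2
      _ = _ := by ring
  · intro z hz
    have := hz.1
    simp [uIcc_of_le hab] at this
    exact this
  · intro z hz
    have := hz.1
    simp [hab] at this
    exact this

theorem integral_vertical_shift [CompleteSpace F] {f : ℂ → F} {a b C : ℝ} (hab : a ≤ b)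
    (hc : ContinuousOn f {z | a ≤ z.re ∧ z.re ≤ b})
    (hd : DifferentiableOn ℂ f {z | a < z.re ∧ z.re < b})
    (hC : ∀ z : ℂ, a ≤ z.re → z.re ≤ b → |z.im| * ‖f z‖ ≤ C)
    (ha : Integrable fun y : ℝ => f (a + y * I)) (hb : Integrable fun y : ℝ => f (b + y * I)) :
    ∫ y : ℝ, f (a + y * I) = ∫ y : ℝ, f (b + y * I) := by
  have h1 := intervalIntegral_tendsto_integral ha tendsto_neg_atTop_atBot tendsto_id
  have h2 := intervalIntegral_tendsto_integral hb tendsto_neg_atTop_atBot tendsto_id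
  exact (sub_eq_zero.1 (tendsto_nhds_unique (h2.sub h1)
    (tendsto_vertical_shift hab hc hd hC))).symm

theorem norm_exp_div_line {d t y : ℝ} :
    ‖exp (t * (d + y * I)) / (d + y * I) ^ 2‖ = Real.exp (t * d) * (d ^ 2 + y ^ 2)⁻¹ := by
  rw [norm_div, norm_exp, norm_pow, normSq_line, div_eq_mul_inv]
  congr 2
  simp

theorem integrable_exp_div_line {d : ℝ} (hd : d ≠ 0) (t : ℝ) :
    Integrable fun y : ℝ => exp (t * (d + y * I)) / (d + y * I) ^ 2 := by
  refine Integrable.mono' ((integrable_inv_sq_add_sq hd).const_mul (Real.exp (t * d))) ?_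
    (Eventually.of_forall fun y => norm_exp_div_line.le)
  refine Continuous.aestronglyMeasurable (Continuous.div (by fun_prop) (by fun_prop) fun y => ?_)
  exact pow_ne_zero _ (line_ne_zero hd y)

/-- The line is pushed to `Re w = n → -∞`, where the integral is at most `π / (-n)`. The condition
`t ≥ 0` keeps the exponential bounded by `1` on the way. -/
theorem integral_exp_div_line {d t : ℝ} (hd : d < 0) (ht : 0 ≤ t) :
    ∫ y : ℝ, exp (t * (d + y * I)) / (d + y * I) ^ 2 = 0 := by
  have hshift : ∀ n : ℝ, n ≤ d →
      ‖∫ y : ℝ, exp (t * (d + y * I)) / (d + y * I) ^ 2‖ ≤ Real.pi / (-n) := by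
    intro n hn
    have hne : ∀ z : ℂ, z.re ≤ d → z ≠ 0 := fun z hz h0 => by
      rw [h0, zero_re] at hz; linarith
    have e := integral_vertical_shift (f := fun w : ℂ => exp (t * w) / w ^ 2) (a := n) (b := d)
      (C := (-d)⁻¹) hn
      (ContinuousOn.div (by fun_prop) (by fun_prop) fun z hz => pow_ne_zero _ (hne z hz.2))
      (DifferentiableOn.div (by fun_prop) (by fun_prop)
        fun z hz => pow_ne_zero _ (hne z hz.2.le)) ?_
      (integrable_exp_div_line (by linarith) t) (integrable_exp_div_line hd.ne t)
    · rw [← e]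
      have h1 : ∀ y : ℝ, ‖exp (t * (n + y * I)) / (n + y * I) ^ 2‖ ≤ ((-n) ^ 2 + y ^ 2)⁻¹ := by
        intro y
        rw [norm_exp_div_line, neg_sq]
        refine mul_le_of_le_one_left (by positivity) ?_
        rw [Real.exp_le_one_iff]
        exact mul_nonpos_of_nonneg_of_nonpos ht (by linarith)
      rw [← integral_inv_sq_add_sq (by linarith : 0 < -n)]
      exact norm_integral_le_of_norm_le (integrable_inv_sq_add_sq (by linarith))
        (Eventually.of_forall h1)
    · intro z hz1 hz2
      have hz : 0 < ‖z‖ := norm_pos_iff.2 (hne z hz2)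
      have h1 : -d ≤ ‖z‖ := by
        have := (neg_le_abs z.re).trans (abs_re_le_norm z)
        linarith
      have h2 : ‖exp (t * z)‖ ≤ 1 := by
        rw [norm_exp, re_ofReal_mul, Real.exp_le_one_iff]
        exact mul_nonpos_of_nonneg_of_nonpos ht (by linarith)
      rw [norm_div, norm_pow]
      calc |z.im| * (‖exp (t * z)‖ / ‖z‖ ^ 2) ≤ ‖z‖ * (1 / ‖z‖ ^ 2) := by
            gcongr; exact abs_im_le_norm z
        _ = ‖z‖⁻¹ := by field_simp
        _ ≤ _ := inv_anti₀ (by linarith) h1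
  rw [← norm_le_zero_iff]
  have hlim : Tendsto (fun m : ℝ => Real.pi / m) atTop (𝓝 0) := tendsto_const_nhds.div_atTop tendsto_id
  refine ge_of_tendsto hlim ?_
  filter_upwards [eventually_ge_atTop (-d)] with m hm
  simpa using hshift (-m) (by linarith)

end Vertical

end SplittingGroup

/-! ### The contour integrals defining the regularized semigroup. -/

namespace SplittingGroup

open MeasureTheory Complex

variable {E : Type*} [NormedAddCommGroup E] [NormedSpace ℂ E]

/-- The regularized semigroup `exp(tA) P R(0)`, where `P` is the spectral projection to the left of
the strip. -/
noncomputable def leftSemigroup (δ : ℝ) (R : ℂ → E →L[ℂ] E) (t : ℝ) : E →L[ℂ] E :=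
  (-(2 * (Real.pi : ℂ))⁻¹) • ∫ y : ℝ,
    (exp (t * ((-δ : ℝ) + y * I)) / ((-δ : ℝ) + y * I)) • R ((-δ : ℝ) + y * I)

/-- The integral `exp(tA) P R(0)²` for `t ≥ 0`, whose derivative is `-leftSemigroup` for all `t`. -/
noncomputable def leftPrimitive (δ : ℝ) (R : ℂ → E →L[ℂ] E) (t : ℝ) : E →L[ℂ] E :=
  (2 * (Real.pi : ℂ))⁻¹ • ∫ y : ℝ,
    (exp (t * ((-δ : ℝ) + y * I)) / ((-δ : ℝ) + y * I) ^ 2) • R ((-δ : ℝ) + y * I)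

namespace IsStripResolvent

variable {A : E →ₗ.[ℂ] E} {δ : ℝ} {R : ℂ → E →L[ℂ] E}

theorem zero (h : IsStripResolvent A δ R) : IsResolvent A 0 (R 0) :=
  h.isResolvent 0 (by simpa using h.pos.le)

theorem left (h : IsStripResolvent A δ R) (y : ℝ) :
    IsResolvent A ((-δ : ℝ) + y * I) (R ((-δ : ℝ) + y * I)) :=
  h.isResolvent _ (by simp [abs_of_pos h.pos])

theorem continuous_left (h : IsStripResolvent A δ R) :
    Continuous fun y : ℝ => R ((-δ : ℝ) + y * I) := by
  have hc : ContinuousOn R {w | |w.re| ≤ δ} := continuousOn_resolvent h.isResolvent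
  exact hc.comp_continuous (by fun_prop) fun y => by simp [abs_of_pos h.pos]

/-- For the first integrand, one factor `1/‖w‖` comes from the scalar and one from the decay of the
resolvent, which suffices for absolute convergence. For the second, boundedness of the resolvent on
the line is enough. -/
theorem exists_bound (h : IsStripResolvent A δ R) : ∃ K, 0 ≤ K ∧ ∀ t y : ℝ,
    ‖(exp (t * ((-δ : ℝ) + y * I)) / ((-δ : ℝ) + y * I)) • R ((-δ : ℝ) + y * I)‖ ≤
      Real.exp (-δ * t) * (K * (δ ^ 2 + y ^ 2)⁻¹) ∧
    ‖(exp (t * ((-δ : ℝ) + y * I)) / ((-δ : ℝ) + y * I) ^ 2) • R ((-δ : ℝ) + y * I)‖ ≤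
      Real.exp (-δ * t) * (K * (δ ^ 2 + y ^ 2)⁻¹) := by
  obtain ⟨K, hK⟩ := h.decay
  have hδ := h.pos
  have hK0 : 0 ≤ K := by
    have := (mul_nonneg (norm_nonneg _) (norm_nonneg _)).trans (hK 0 (by simpa using hδ.le))
    exact this
  refine ⟨max K (K / δ), le_max_of_le_left hK0, fun t y => ?_⟩
  set w : ℂ := (-δ : ℝ) + y * I with hw
  have hre : w.re = -δ := by simp [hw]
  have hwn : 0 < ‖w‖ := norm_pos_iff.2 (line_ne_zero (neg_ne_zero.2 hδ.ne') y)
  have hsq : (δ ^ 2 + y ^ 2)⁻¹ = (‖w‖ ^ 2)⁻¹ := by rw [hw, normSq_line, neg_sq]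
  have hwδ : δ ≤ ‖w‖ := by
    have := abs_re_le_norm w
    rwa [hre, abs_neg, abs_of_pos hδ] at this
  have hRw : ‖R w‖ ≤ K / ‖w‖ := by
    rw [le_div_iff₀ hwn, mul_comm]
    exact hK w (by rw [hre, abs_neg, abs_of_pos hδ])
  have he : ‖exp (t * w)‖ = Real.exp (-δ * t) := by
    rw [norm_exp, re_ofReal_mul, hre, mul_comm]
  rw [hsq, norm_smul, norm_smul, norm_div, norm_div, norm_pow, he]
  constructor
  · calc Real.exp (-δ * t) / ‖w‖ * ‖R w‖ ≤ Real.exp (-δ * t) / ‖w‖ * (K / ‖w‖) := by gcongr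
      _ = Real.exp (-δ * t) * (K * (‖w‖ ^ 2)⁻¹) := by field_simp
      _ ≤ _ := by gcongr; exact le_max_left _ _
  · calc Real.exp (-δ * t) / ‖w‖ ^ 2 * ‖R w‖ ≤ Real.exp (-δ * t) / ‖w‖ ^ 2 * (K / δ) := by
          gcongr
          exact hRw.trans (by gcongr)
      _ = Real.exp (-δ * t) * (K / δ * (‖w‖ ^ 2)⁻¹) := by field_simp
      _ ≤ _ := by gcongr; exact le_max_right _ _

theorem continuous_integrand (h : IsStripResolvent A δ R) (t : ℝ) :
    Continuous fun y : ℝ =>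
      (exp (t * ((-δ : ℝ) + y * I)) / ((-δ : ℝ) + y * I)) • R ((-δ : ℝ) + y * I) :=
  (Continuous.div (by fun_prop) (by fun_prop)
    (line_ne_zero (neg_ne_zero.2 h.pos.ne'))).smul h.continuous_left

theorem continuous_integrand_sq (h : IsStripResolvent A δ R) (t : ℝ) :
    Continuous fun y : ℝ =>
      (exp (t * ((-δ : ℝ) + y * I)) / ((-δ : ℝ) + y * I) ^ 2) • R ((-δ : ℝ) + y * I) :=
  (Continuous.div (by fun_prop) (by fun_prop)
    fun y => pow_ne_zero 2 (line_ne_zero (neg_ne_zero.2 h.pos.ne') y)).smul h.continuous_left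

theorem integrable_integrand (h : IsStripResolvent A δ R) (t : ℝ) :
    Integrable fun y : ℝ =>
      (exp (t * ((-δ : ℝ) + y * I)) / ((-δ : ℝ) + y * I)) • R ((-δ : ℝ) + y * I) := by
  obtain ⟨K, hK, hb⟩ := h.exists_bound
  exact Integrable.mono' (((integrable_inv_sq_add_sq h.pos.ne').const_mul K).const_mul _)
    (h.continuous_integrand t).aestronglyMeasurable (Eventually.of_forall fun y => (hb t y).1)

theorem integrable_integrand_sq (h : IsStripResolvent A δ R) (t : ℝ) :
    Integrable fun y : ℝ =>
      (exp (t * ((-δ : ℝ) + y * I)) / ((-δ : ℝ) + y * I) ^ 2) • R ((-δ : ℝ) + y * I) := by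
  obtain ⟨K, hK, hb⟩ := h.exists_bound
  exact Integrable.mono' (((integrable_inv_sq_add_sq h.pos.ne').const_mul K).const_mul _)
    (h.continuous_integrand_sq t).aestronglyMeasurable (Eventually.of_forall fun y => (hb t y).2)

theorem exists_norm_le (h : IsStripResolvent A δ R) : ∃ C, ∀ t,
    ‖leftSemigroup δ R t‖ ≤ C * Real.exp (-δ * t) ∧
    ‖leftPrimitive δ R t‖ ≤ C * Real.exp (-δ * t) := by
  obtain ⟨K, hK, hb⟩ := h.exists_bound
  set J := ∫ y : ℝ, K * (δ ^ 2 + y ^ 2)⁻¹ with hJ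
  refine ⟨‖(2 * (Real.pi : ℂ))⁻¹‖ * J, fun t => ?_⟩
  have hint := ((integrable_inv_sq_add_sq h.pos.ne').const_mul K).const_mul (Real.exp (-δ * t))
  have h1 := norm_integral_le_of_norm_le hint (Eventually.of_forall fun y => (hb t y).1)
  have h2 := norm_integral_le_of_norm_le hint (Eventually.of_forall fun y => (hb t y).2)
  rw [integral_const_mul] at h1 h2
  rw [leftSemigroup, leftPrimitive, norm_smul, norm_smul, norm_neg, mul_assoc, mul_comm J]
  exact ⟨by gcongr, by gcongr⟩

theorem continuousOn_leftSemigroup (h : IsStripResolvent A δ R) :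
    ContinuousOn (leftSemigroup δ R) (Ici 0) := by
  obtain ⟨K, hK, hb⟩ := h.exists_bound
  refine ContinuousOn.const_smul (M := ℂ) (continuousOn_of_dominated
    (bound := fun y => K * (δ ^ 2 + y ^ 2)⁻¹)
    (fun t _ => (h.continuous_integrand t).aestronglyMeasurable) (fun t ht => ?_)
    ((integrable_inv_sq_add_sq h.pos.ne').const_mul K) (Eventually.of_forall fun y => ?_)) _
  · refine Eventually.of_forall fun y => ((hb t y).1).trans (mul_le_of_le_one_left (by positivity) ?_)
    rw [Real.exp_le_one_iff, neg_mul, neg_nonpos]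
    exact mul_nonneg h.pos.le ht
  · fun_prop

theorem hasDerivAt_leftPrimitive (h : IsStripResolvent A δ R) (t : ℝ) :
    HasDerivAt (leftPrimitive δ R) (-leftSemigroup δ R t) t := by
  obtain ⟨K, hK, hb⟩ := h.exists_bound
  have hδ := h.pos
  have key := (hasDerivAt_integral_of_dominated_loc_of_deriv_le (μ := (volume : Measure ℝ))
    (F := fun (t : ℝ) (y : ℝ) =>
      (exp (t * ((-δ : ℝ) + y * I)) / ((-δ : ℝ) + y * I) ^ 2) • R ((-δ : ℝ) + y * I))
    (F' := fun (t : ℝ) (y : ℝ) =>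
      (exp (t * ((-δ : ℝ) + y * I)) / ((-δ : ℝ) + y * I)) • R ((-δ : ℝ) + y * I))
    (bound := fun y => Real.exp (δ * (1 - t)) * (K * (δ ^ 2 + y ^ 2)⁻¹))
    (Metric.ball_mem_nhds t one_pos)
    (Eventually.of_forall fun s => (h.continuous_integrand_sq s).aestronglyMeasurable)
    (h.integrable_integrand_sq t) (h.continuous_integrand t).aestronglyMeasurable
    (Eventually.of_forall fun y s hs => ((hb s y).1).trans ?_)
    (((integrable_inv_sq_add_sq hδ.ne').const_mul K).const_mul _)
    (Eventually.of_forall fun y s _ => ?_)).2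
  · have := key.const_smul (2 * (Real.pi : ℂ))⁻¹
    rw [leftSemigroup, neg_smul, neg_neg]
    exact this
  · have h1 : |s - t| < 1 := by simpa [Real.dist_eq] using hs
    have := (abs_lt.1 h1).1
    refine mul_le_mul_of_nonneg_right (Real.exp_le_exp.2 (by nlinarith)) (by positivity)
  · have hne := line_ne_zero (neg_ne_zero.2 hδ.ne') y
    have h1 : HasDerivAt (fun s : ℝ => exp (s * ((-δ : ℝ) + y * I)))
        (exp (s * ((-δ : ℝ) + y * I)) * ((-δ : ℝ) + y * I)) s := by
      have := ((ofRealCLM.hasDerivAt (x := s)).mul_const (((-δ : ℝ) + y * I) : ℂ)).cexp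
      simpa using this
    have h2 := (h1.div_const (((-δ : ℝ) + y * I : ℂ) ^ 2)).smul_const (R ((-δ : ℝ) + y * I))
    convert h2 using 2
    field_simp

theorem commute_leftSemigroup (h : IsStripResolvent A δ R) [CompleteSpace E] {B : E →L[ℂ] E}
    (hB : ∀ w : ℂ, |w.re| ≤ δ → Commute B (R w)) (t : ℝ) : Commute B (leftSemigroup δ R t) := by
  have h1 := ((ContinuousLinearMap.mul ℂ (E →L[ℂ] E)) B).integral_comp_comm
    (h.integrable_integrand t)
  have h2 := (((ContinuousLinearMap.mul ℂ (E →L[ℂ] E)).flip) B).integral_comp_comm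
    (h.integrable_integrand t)
  simp only [ContinuousLinearMap.mul_apply', ContinuousLinearMap.flip_apply] at h1 h2
  refine Commute.smul_right ?_ _
  rw [Commute, SemiconjBy, ← h1, ← h2]
  refine integral_congr_ae (Eventually.of_forall fun y => ?_)
  exact ((hB _ (by simp [abs_of_pos h.pos])).smul_right _).eq

theorem commute_resolvent (h : IsStripResolvent A δ R) {w : ℂ} (hw : |w.re| ≤ δ) :
    Commute (R 0) (R w) :=
  h.zero.commute_resolvent (h.isResolvent w hw)

/-- Under the integral `R(w) R(0) = w⁻¹ (R(0) - R(w))`, and the scalar integral multiplying `R(0)`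
vanishes for `t ≥ 0`. With `hasDerivAt_leftPrimitive` this says that `V t * R 0` has derivative `-V
t` for `t > 0`. -/
theorem leftSemigroup_mul_resolvent [CompleteSpace E] (h : IsStripResolvent A δ R) {t : ℝ}
    (ht : 0 ≤ t) : leftSemigroup δ R t * R 0 = leftPrimitive δ R t := by
  have h2 := (((ContinuousLinearMap.mul ℂ (E →L[ℂ] E)).flip) (R 0)).integral_comp_comm
    (h.integrable_integrand t)
  simp only [ContinuousLinearMap.mul_apply', ContinuousLinearMap.flip_apply] at h2
  have hδ : -δ < 0 := neg_neg_of_pos h.pos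
  have h3 : ∀ y : ℝ, (exp (t * ((-δ : ℝ) + y * I)) / ((-δ : ℝ) + y * I)) •
        R ((-δ : ℝ) + y * I) * R 0 =
      (exp (t * ((-δ : ℝ) + y * I)) / ((-δ : ℝ) + y * I) ^ 2) • R 0 -
      (exp (t * ((-δ : ℝ) + y * I)) / ((-δ : ℝ) + y * I) ^ 2) • R ((-δ : ℝ) + y * I) := by
    intro y
    have hne := line_ne_zero hδ.ne y
    set w : ℂ := (-δ : ℝ) + y * I
    have h4 := (h.left y).sub_eq h.zero
    change R w - R 0 = (0 - w) • (R w * R 0) at h4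
    have h5 : R w * R 0 = w⁻¹ • (R 0 - R w) := by
      rw [← neg_sub, h4, zero_sub, neg_smul, neg_neg, smul_smul, inv_mul_cancel₀ hne, one_smul]
    rw [smul_mul_assoc, h5, smul_smul, ← smul_sub]
    congr 1
    field_simp
  rw [leftSemigroup, leftPrimitive, smul_mul_assoc, ← h2]
  simp_rw [h3]
  rw [integral_sub ((integrable_exp_div_line hδ.ne t).smul_const _) (h.integrable_integrand_sq t),
    integral_smul_const, integral_exp_div_line hδ ht, zero_smul, zero_sub, smul_neg, neg_smul,
    neg_neg]

end IsStripResolvent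

end SplittingGroup

/-! ### Semigroup law, orthogonality, and decomposition of `R 0`. -/

namespace SplittingGroup

open MeasureTheory Complex

variable {E : Type*} [NormedAddCommGroup E] [NormedSpace ℂ E]

theorem IsResolvent.cancel_left {A : E →ₗ.[ℂ] E} {μ : ℂ} {R P Q : E →L[ℂ] E}
    (h : IsResolvent A μ R) (e : R * P = R * Q) : P = Q := by
  ext x
  exact h.injective (DFunLike.congr_fun e x)

namespace IsStripResolvent

variable {A : E →ₗ.[ℂ] E} {δ : ℝ} {R : ℂ → E →L[ℂ] E} [CompleteSpace E]

theorem commute_leftSemigroup_resolvent (h : IsStripResolvent A δ R) (t : ℝ) {w : ℂ}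
    (hw : |w.re| ≤ δ) : Commute (leftSemigroup δ R t) (R w) :=
  (h.commute_leftSemigroup
    (fun v hv => (h.isResolvent w hw).commute_resolvent (h.isResolvent v hv)) t).symm

theorem commute_leftSemigroup_zero (h : IsStripResolvent A δ R) (t : ℝ) :
    Commute (leftSemigroup δ R t) (R 0) :=
  h.commute_leftSemigroup_resolvent t (by simpa using h.pos.le)

/-- The product `W (s + t - r) * W r` has zero derivative in `r`, because `W = R(0) V` and
everything commutes. Comparing `r = t` with `r = 0` and cancelling `R(0)` twice replaces a double
contour integral. -/
theorem leftSemigroup_mul (h : IsStripResolvent A δ R) {s t : ℝ} (hs : 0 ≤ s) (ht : 0 ≤ t) :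
    leftSemigroup δ R s * leftSemigroup δ R t = leftSemigroup δ R (s + t) * leftSemigroup δ R 0 := by
  set V := leftSemigroup δ R
  set W := leftPrimitive δ R
  have hW : ∀ r, 0 ≤ r → W r = R 0 * V r := fun r hr => by
    rw [← (h.commute_leftSemigroup_zero r).eq]
    exact (h.leftSemigroup_mul_resolvent hr).symm
  have hd : ∀ r, HasDerivAt (fun r => W (s + t - r) * W r)
      (V (s + t - r) * W r - W (s + t - r) * V r) r := fun r => by
    have h1 := (h.hasDerivAt_leftPrimitive (s + t - r)).scomp r ((hasDerivAt_id r).const_sub (s + t))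
    have h2 := h1.mul (h.hasDerivAt_leftPrimitive r)
    refine h2.congr_deriv ?_
    simp only [neg_smul, one_smul, neg_neg, mul_neg, ← sub_eq_add_neg]
    rfl
  have hconst := constant_of_has_deriv_right_zero (a := 0) (b := s + t)
    (f := fun r => W (s + t - r) * W r) (fun r _ => (hd r).continuousAt.continuousWithinAt)
    (fun r hr => by
      convert (hd r).hasDerivWithinAt using 1
      rw [hW r hr.1, hW (s + t - r) (by linarith [hr.2]), ← mul_assoc,
        (h.commute_leftSemigroup_zero _).eq, sub_self])
    t ⟨ht, by linarith⟩
  simp only [sub_zero, add_sub_cancel_right] at hconst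
  rw [hW s hs, hW t ht, hW 0 le_rfl, hW (s + t) (by linarith), mul_assoc, mul_assoc, ← mul_assoc (V s),
    ← mul_assoc (V (s + t)), (h.commute_leftSemigroup_zero _).eq,
    (h.commute_leftSemigroup_zero _).eq, mul_assoc, mul_assoc] at hconst
  exact h.zero.cancel_left (h.zero.cancel_left hconst)

/-- Formally `exp(-rA) P₂` times `exp((r + t)A) P₁` does not depend on `r`. Both factors decay like
`exp (-δ r)`, so the constant is zero. -/
theorem leftSemigroup_neg_mul (h : IsStripResolvent A δ R) {t : ℝ} (ht : 0 ≤ t) :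
    leftSemigroup δ (fun w => -R (-w)) 0 * leftSemigroup δ R t = 0 := by
  set V := leftSemigroup δ R
  set W := leftPrimitive δ R
  set V' := leftSemigroup δ (fun w => -R (-w))
  set W' := leftPrimitive δ (fun w => -R (-w))
  have hW : ∀ r, 0 ≤ r → W r = R 0 * V r := fun r hr => by
    rw [← (h.commute_leftSemigroup_zero r).eq]
    exact (h.leftSemigroup_mul_resolvent hr).symm
  have hW' : ∀ r, 0 ≤ r → W' r = -(V' r * R 0) := fun r hr => by
    have := (h.neg.leftSemigroup_mul_resolvent hr).symm
    simpa using this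
  have hR' : ∀ r, Commute (V' r) (R 0) := fun r => by
    simpa using (h.neg.commute_leftSemigroup_zero r).neg_right
  have hd : ∀ r, HasDerivAt (fun r => W' r * W (r + t))
      (-(V' r * W (r + t)) - W' r * V (r + t)) r := fun r => by
    have h1 := (h.hasDerivAt_leftPrimitive (r + t)).comp_add_const r t
    have h2 := (h.neg.hasDerivAt_leftPrimitive r).mul h1
    refine h2.congr_deriv ?_
    simp only [neg_mul, mul_neg, ← sub_eq_add_neg]
    rfl
  have hconst : ∀ s, 0 ≤ s → W' s * W (s + t) = W' 0 * W t := fun s hs => by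
    have := constant_of_has_deriv_right_zero (a := 0) (b := s)
      (f := fun r => W' r * W (r + t)) (fun r _ => (hd r).continuousAt.continuousWithinAt)
      (fun r hr => by
        convert (hd r).hasDerivWithinAt using 1
        rw [hW (r + t) (add_nonneg hr.1 ht), hW' r hr.1]
        simp [mul_assoc])
      s ⟨hs, le_rfl⟩
    simpa using this
  obtain ⟨C, hC⟩ := h.exists_norm_le
  obtain ⟨C', hC'⟩ := h.neg.exists_norm_le
  have hexp : Tendsto (fun s : ℝ => Real.exp (-δ * s)) atTop (𝓝 0) := by
    refine Real.tendsto_exp_atBot.comp ?_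
    exact tendsto_id.const_mul_atTop_of_neg (neg_neg_of_pos h.pos)
  have hlim : Tendsto (fun s : ℝ => C' * Real.exp (-δ * s) * (C * Real.exp (-δ * (s + t)))) atTop
      (𝓝 (C' * 0 * (C * 0))) :=
    (hexp.const_mul C').mul ((hexp.comp (tendsto_atTop_add_const_right _ t tendsto_id)).const_mul C)
  have hzero : W' 0 * W t = 0 := by
    rw [← norm_le_zero_iff]
    rw [mul_zero, zero_mul] at hlim
    refine ge_of_tendsto hlim ?_
    filter_upwards [eventually_ge_atTop 0] with s hs
    rw [← hconst s hs]
    have h1 : ‖W' s‖ ≤ _ := (hC' s).2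
    have h2 : ‖W (s + t)‖ ≤ _ := (hC (s + t)).2
    exact (norm_mul_le _ _).trans
      (mul_le_mul h1 h2 (norm_nonneg _) ((norm_nonneg _).trans h1))
  rw [hW' 0 le_rfl, hW t ht, neg_mul, neg_eq_zero, (hR' 0).eq, mul_assoc, ← mul_assoc (V' 0),
    (hR' 0).eq, mul_assoc] at hzero
  refine h.zero.cancel_left (h.zero.cancel_left ?_)
  rw [hzero, mul_zero, mul_zero]

/-- Split `w⁻¹ R(w) = w⁻¹ R(0) - R(w) R(0)`. The last term is holomorphic across the whole strip, so
its integrals along the two edges cancel in the limit. The difference of `w⁻¹` on the edges is the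
Poisson-type kernel `2δ / (δ² + y²)`, of mass `2π`. -/
theorem leftSemigroup_sub_neg (h : IsStripResolvent A δ R) :
    leftSemigroup δ R 0 - leftSemigroup δ (fun w => -R (-w)) 0 = R 0 := by
  have hδ := h.pos
  set f : ℂ → E →L[ℂ] E := fun w => w⁻¹ • R w with hf
  set g : ℂ → E →L[ℂ] E := fun w => R w * R 0 with hg
  have hfg : ∀ w : ℂ, |w.re| ≤ δ → w ≠ 0 → f w = w⁻¹ • R 0 - g w := by
    intro w hw hw0
    have h4 := (h.isResolvent w hw).sub_eq h.zero
    have h5 : g w = w⁻¹ • (R 0 - R w) := by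
      rw [← neg_sub, h4, zero_sub, neg_smul, neg_neg, smul_smul, inv_mul_cancel₀ hw0, one_smul]
    rw [h5, smul_sub, sub_sub_cancel]
  have hfl : ∀ y : ℝ, f ((-δ : ℝ) + y * I) = (exp ((0 : ℝ) * ((-δ : ℝ) + y * I)) /
      ((-δ : ℝ) + y * I)) • R ((-δ : ℝ) + y * I) := fun y => by simp [hf]
  -- The reflection `w ↦ -w` carries the integral for `-A` on the left edge to that of `f` on the
  -- right edge, with `y` reversed.
  have hfr : ∀ y : ℝ, f ((δ : ℝ) + y * I) = (exp ((0 : ℝ) * ((-δ : ℝ) + (-y : ℝ) * I)) /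
      ((-δ : ℝ) + (-y : ℝ) * I)) • -R (-((-δ : ℝ) + (-y : ℝ) * I)) := fun y => by
    have e : ((-δ : ℝ) + (-y : ℝ) * I : ℂ) = -((δ : ℝ) + y * I) := by push_cast; ring
    rw [e]
    simp only [hf, ofReal_zero, zero_mul, exp_zero, neg_neg, smul_neg, one_div, inv_neg, neg_smul]
  have hil : Integrable fun y : ℝ => f ((-δ : ℝ) + y * I) := by
    simp_rw [hfl]; exact h.integrable_integrand 0
  have hir : Integrable fun y : ℝ => f ((δ : ℝ) + y * I) := by
    simp_rw [hfr]; exact (h.neg.integrable_integrand 0).comp_neg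
  have hVl : leftSemigroup δ R 0 = (-(2 * (Real.pi : ℂ))⁻¹) • ∫ y : ℝ, f ((-δ : ℝ) + y * I) := by
    simp_rw [hfl]; rfl
  have hVr : leftSemigroup δ (fun w => -R (-w)) 0 =
      (-(2 * (Real.pi : ℂ))⁻¹) • ∫ y : ℝ, f ((δ : ℝ) + y * I) := by
    simp_rw [hfr]
    rw [leftSemigroup, integral_neg_eq_self (fun y : ℝ => (exp ((0 : ℝ) * ((-δ : ℝ) + y * I)) /
      ((-δ : ℝ) + y * I)) • -R (-((-δ : ℝ) + y * I)))]
  have hcont : ContinuousOn R {w | |w.re| ≤ δ} := continuousOn_resolvent h.isResolvent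
  obtain ⟨K, hK⟩ := h.decay
  have hshift := tendsto_vertical_shift (f := g) (a := -δ) (b := δ) (C := K * ‖R 0‖) (by linarith)
    ((hcont.mono fun w hw => abs_le.2 hw).mul continuousOn_const)
    (fun w hw => by
      have hs : {w : ℂ | |w.re| ≤ δ} ∈ 𝓝 w := by
        have : ∀ᶠ v : ℂ in 𝓝 w, |v.re| < δ :=
          (continuous_abs.comp continuous_re).continuousAt.eventually (gt_mem_nhds (abs_lt.2 hw))
        exact this.mono fun v hv => hv.le
      exact ((hasDerivAt_resolvent h.isResolvent hs).mul_const
        (R 0)).differentiableAt.differentiableWithinAt)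
    (fun w h1 h2 => by
      have h3 := hK w (abs_le.2 ⟨h1, h2⟩)
      calc |w.im| * ‖R w * R 0‖ ≤ ‖w‖ * (‖R w‖ * ‖R 0‖) := by
            gcongr
            · exact abs_im_le_norm w
            · exact norm_mul_le _ _
        _ = ‖w‖ * ‖R w‖ * ‖R 0‖ := by ring
        _ ≤ _ := by gcongr)
  have hpoisson : Integrable fun y : ℝ => ((2 * δ * (δ ^ 2 + y ^ 2)⁻¹ : ℝ) : ℂ) • R 0 :=
    (((integrable_inv_sq_add_sq hδ.ne').const_mul _).ofReal).smul_const _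
  have hpt : ∀ y : ℝ, f (δ + y * I) - f ((-δ : ℝ) + y * I) =
      ((2 * δ * (δ ^ 2 + y ^ 2)⁻¹ : ℝ) : ℂ) • R 0 - (g (δ + y * I) - g ((-δ : ℝ) + y * I)) := by
    intro y
    have hn1 := line_ne_zero hδ.ne' y
    have hn2 := line_ne_zero (neg_ne_zero.2 hδ.ne') y
    rw [hfg _ (by simp [abs_of_pos hδ]) hn1, hfg _ (by simp [abs_of_pos hδ]) hn2]
    have e : ((2 * δ * (δ ^ 2 + y ^ 2)⁻¹ : ℝ) : ℂ) =
        (δ + y * I : ℂ)⁻¹ - ((-δ : ℝ) + y * I : ℂ)⁻¹ := by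
      have h1 : ((δ ^ 2 + y ^ 2 : ℝ) : ℂ) = -((δ + y * I) * ((-δ : ℝ) + y * I)) := by
        push_cast
        linear_combination ((y : ℂ) ^ 2) * I_sq
      rw [ofReal_mul, ofReal_inv, h1]
      field_simp
      push_cast
      ring
    rw [e, sub_smul]
    abel
  have hcg : ∀ d : ℝ, |d| ≤ δ → Continuous fun y : ℝ => g (d + y * I) := fun d hd =>
    (hcont.comp_continuous (by fun_prop) fun y => by simpa using hd).mul continuous_const
  -- The estimate for `g` is only `O(1/‖w‖)`, so its edge integrals are treated as symmetric
  -- truncations; only the difference is shown to converge.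
  have hlim := (intervalIntegral_tendsto_integral hpoisson tendsto_neg_atTop_atBot tendsto_id).sub
    hshift
  have hlim' := intervalIntegral_tendsto_integral (hir.sub hil) tendsto_neg_atTop_atBot tendsto_id
  have heq : ∫ y : ℝ, (f (δ + y * I) - f ((-δ : ℝ) + y * I)) = ((2 * Real.pi : ℝ) : ℂ) • R 0 := by
    have h1 := tendsto_nhds_unique (hlim'.congr fun Y => ?_) hlim
    · have h2 : ∫ y : ℝ, ((2 * δ * (δ ^ 2 + y ^ 2)⁻¹ : ℝ) : ℂ) =
          ((∫ y : ℝ, 2 * δ * (δ ^ 2 + y ^ 2)⁻¹ : ℝ) : ℂ) := integral_ofReal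
      rw [sub_zero, integral_smul_const, h2, integral_const_mul, integral_inv_sq_add_sq hδ] at h1
      rw [← (by field_simp : 2 * δ * (Real.pi / δ) = 2 * Real.pi)]
      exact h1
    · have hi1 : IntervalIntegrable (fun y : ℝ => ((2 * δ * (δ ^ 2 + y ^ 2)⁻¹ : ℝ) : ℂ) • R 0)
          volume (-Y) Y := hpoisson.intervalIntegrable
      have hi2 := (hcg δ (abs_of_pos hδ).le).intervalIntegrable (μ := volume) (-Y) Y
      have hi3 := (hcg (-δ) (by rw [abs_neg, abs_of_pos hδ])).intervalIntegrable (μ := volume) (-Y) Y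
      simp only [id_eq]
      rw [← intervalIntegral.integral_sub hi2 hi3, ← intervalIntegral.integral_sub hi1 (hi2.sub hi3)]
      exact intervalIntegral.integral_congr fun y _ => hpt y
  rw [hVl, hVr, ← smul_sub, ← neg_sub, ← integral_sub hir hil, heq, smul_neg, neg_smul, neg_neg,
    smul_smul]
  have hpi : (Real.pi : ℂ) ≠ 0 := ofReal_ne_zero.2 Real.pi_ne_zero
  have e : (2 * (Real.pi : ℂ))⁻¹ * ((2 * Real.pi : ℝ) : ℂ) = 1 := by
    push_cast
    field_simp
  rw [e, one_smul]

end IsStripResolvent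

end SplittingGroup

/-! ### The spectral subspaces and the restricted operators. -/

namespace SplittingGroup

open MeasureTheory Complex

variable {E : Type*} [NormedAddCommGroup E] [NormedSpace ℂ E]

/-- The restriction of a bounded operator to an invariant subspace. -/
def restrictCLM (F : Submodule ℂ E) (B : E →L[ℂ] E) (hB : ∀ x ∈ F, B x ∈ F) : F →L[ℂ] F :=
  (B.comp F.subtypeL).codRestrict F fun x => hB x x.2

@[simp]
theorem coe_restrictCLM_apply (F : Submodule ℂ E) (B : E →L[ℂ] E) (hB : ∀ x ∈ F, B x ∈ F) (x : F) :
    (restrictCLM F B hB x : E) = B x := rfl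

theorem norm_restrictCLM_le (F : Submodule ℂ E) (B : E →L[ℂ] E) (hB : ∀ x ∈ F, B x ∈ F) :
    ‖restrictCLM F B hB‖ ≤ ‖B‖ :=
  ContinuousLinearMap.opNorm_le_bound _ (norm_nonneg _) fun x => B.le_opNorm x

theorem hasDerivAt_subtype {F : Submodule ℂ E} {f : ℝ → F} {f' : F} {t : ℝ}
    (h : HasDerivAt (fun s => (f s : E)) (f' : E) t) : HasDerivAt f f' t := by
  rw [hasDerivAt_iff_isLittleO] at h ⊢
  refine Asymptotics.IsLittleO.of_norm_left (h.norm_left.congr_left fun s => ?_)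
  rfl

theorem IsResolvent.restrict {A : E →ₗ.[ℂ] E} {μ : ℂ} {R : E →L[ℂ] E} (h : IsResolvent A μ R)
    (F : Submodule ℂ E) (hF : ∀ x ∈ F, R x ∈ F) :
    IsResolvent (restrict A F) μ (restrictCLM F R hF) :=
  ⟨fun _ _ hxy => Subtype.ext (h.left_inv _ _ (mem_graph_restrict.1 hxy)),
    fun y => mem_graph_restrict.2 (h.mem_graph y)⟩

theorem restrict_neg (A : E →ₗ.[ℂ] E) (F : Submodule ℂ E) : restrict (-A) F = -restrict A F := by
  refine LinearPMap.eq_of_eq_graph (Submodule.ext fun ⟨x, y⟩ => ?_)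
  rw [mem_graph_restrict, mem_graph_neg, mem_graph_neg, mem_graph_restrict]
  rfl

theorem neg_mem_resolventSet {A : E →ₗ.[ℂ] E} {μ : ℂ} (h : μ ∈ resolventSet (-A)) :
    -μ ∈ resolventSet A := by
  obtain ⟨R, hR⟩ := mem_resolventSet_iff.1 h
  have := hR.neg
  rw [neg_neg] at this
  exact mem_resolventSet_iff.2 ⟨_, this⟩

theorem mem_ker_of_commute {P B : E →L[ℂ] E} (h : Commute B P) {x : E}
    (hx : x ∈ LinearMap.ker P.toLinearMap) : B x ∈ LinearMap.ker P.toLinearMap := by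
  have hx : P x = 0 := hx
  change P (B x) = 0
  rw [← mul_apply_eq_comp, ← h.eq, mul_apply_eq_comp, hx, map_zero]

theorem IsGroupGenerator.commute_resolvent {U : ℝ → E →L[ℂ] E} (hU : IsC0Group U)
    {A : E →ₗ.[ℂ] E} (hA : IsGroupGenerator U (I • A)) {μ : ℂ} {R : E →L[ℂ] E}
    (hR : IsResolvent A μ R) (s : ℝ) : Commute (U s) R := by
  refine hR.commute fun x y h => ?_
  have h1 : (x, I • y) ∈ (I • A).graph := by
    rw [mem_graph_smul I_ne_zero, inv_smul_smul₀ I_ne_zero]; exact h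
  have h2 := hA.map_mem_graph hU s h1
  rwa [mem_graph_smul I_ne_zero, map_smul, inv_smul_smul₀ I_ne_zero] at h2

namespace IsStripResolvent

variable {A : E →ₗ.[ℂ] E} {δ : ℝ} {R : ℂ → E →L[ℂ] E}

/-- The spectral subspace belonging to the part of the spectrum to the left of the strip. -/
noncomputable def leftSpace (δ : ℝ) (R : ℂ → E →L[ℂ] E) : Submodule ℂ E :=
  LinearMap.ker (leftSemigroup δ (fun w => -R (-w)) 0).toLinearMap

theorem leftSpace_neg (δ : ℝ) (R : ℂ → E →L[ℂ] E) :
    leftSpace δ (fun w => -R (-w)) = LinearMap.ker (leftSemigroup δ R 0).toLinearMap := by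
  simp [leftSpace]

theorem isClosed_leftSpace (δ : ℝ) (R : ℂ → E →L[ℂ] E) :
    IsClosed (leftSpace δ R : Set E) :=
  (leftSemigroup δ (fun w => -R (-w)) 0).isClosed_ker

variable [CompleteSpace E]

theorem leftSemigroup_mem (h : IsStripResolvent A δ R) {t : ℝ} (ht : 0 ≤ t) (x : E) :
    leftSemigroup δ R t x ∈ leftSpace δ R :=
  DFunLike.congr_fun (h.leftSemigroup_neg_mul ht) x

theorem leftSemigroup_neg_mem (h : IsStripResolvent A δ R) (x : E) :
    leftSemigroup δ (fun w => -R (-w)) 0 x ∈ leftSpace δ (fun w => -R (-w)) :=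
  h.neg.leftSemigroup_mem le_rfl x

theorem map_leftSpace (h : IsStripResolvent A δ R) {B : E →L[ℂ] E}
    (hB : ∀ w : ℂ, |w.re| ≤ δ → Commute B (R w)) {x : E} (hx : x ∈ leftSpace δ R) :
    B x ∈ leftSpace δ R :=
  mem_ker_of_commute (h.neg.commute_leftSemigroup
    (fun w hw => (hB (-w) (by simpa using hw)).neg_right) 0) hx

theorem mem_resolventSet_restrict (h : IsStripResolvent A δ R) {μ : ℂ} (hμ : μ ∈ resolventSet A) :
    μ ∈ resolventSet (restrict A (leftSpace δ R)) := by
  obtain ⟨S, hS⟩ := mem_resolventSet_iff.1 hμ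
  exact mem_resolventSet_iff.2 ⟨_, hS.restrict _ fun x hx =>
    h.map_leftSpace (fun w hw => hS.commute_resolvent (h.isResolvent w hw)) hx⟩

/-- On `leftSpace` the operator `V' 0` vanishes, so `V 0 - V' 0 = R 0` reduces to `V 0 = R 0`. This
is the initial value needed for a `RegularizedSemigroup`. -/
theorem generatesHolomorphic (h : IsStripResolvent A δ R) {U : ℝ → E →L[ℂ] E} (hU : IsC0Group U)
    (hA : IsGroupGenerator U (I • A)) :
    GeneratesHolomorphic (restrict A (leftSpace δ R)) (Real.pi / 2) ∧
      ∀ μ : ℂ, 0 < μ.re → μ ∈ resolventSet (restrict A (leftSpace δ R)) := by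
  have hUR : ∀ s, ∀ w : ℂ, |w.re| ≤ δ → Commute (U s) (R w) := fun s w hw =>
    hA.commute_resolvent hU (h.isResolvent w hw) s
  have h0 : |(0 : ℂ).re| ≤ δ := by simpa using h.pos.le
  set F := leftSpace δ R with hF
  have hUF : ∀ s, ∀ x ∈ F, U s x ∈ F := fun s x hx => h.map_leftSpace (hUR s) hx
  have hRF : ∀ x ∈ F, R 0 x ∈ F := fun x hx => h.map_leftSpace (fun w hw => h.commute_resolvent hw) hx
  have hVF : ∀ s, ∀ x ∈ F, leftSemigroup δ R s x ∈ F := fun s x hx =>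
    h.map_leftSpace (fun w hw => h.commute_leftSemigroup_resolvent s hw) hx
  have : CompleteSpace F := (isClosed_leftSpace δ R).completeSpace_coe
  have hreg : RegularizedSemigroup (fun s => restrictCLM F (U s) (hUF s))
      (restrictCLM F (R 0) hRF) (fun s => restrictCLM F (leftSemigroup δ R s) (hVF s)) := by
    refine ⟨⟨?_, ?_, ?_⟩, ?_, ?_, ?_, ?_, ?_, ?_, ?_, ?_, ?_, ?_⟩
    · ext x; simp [hU.map_zero]
    · intro s t; ext x; simp [hU.map_add]
    · intro x
      exact (hU.strong_cont x).subtype_mk _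
    · intro x y hxy
      exact Subtype.ext (h.zero.injective (congrArg Subtype.val hxy))
    · intro s
      ext x
      exact DFunLike.congr_fun (hUR s 0 h0).eq (x : E)
    · intro x t
      refine hasDerivAt_subtype ?_
      have h1 : (R 0 (x : E), I • (-(x : E))) ∈ (I • A).graph := by
        rw [mem_graph_smul I_ne_zero, inv_smul_smul₀ I_ne_zero]
        simpa using h.zero.mem_graph (x : E)
      refine (hA.hasDerivAt hU h1 t).congr_deriv ?_
      simp
    · intro s
      ext x
      exact DFunLike.congr_fun (h.commute_leftSemigroup_zero s).eq (x : E)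
    · intro s t
      ext x
      exact DFunLike.congr_fun (h.commute_leftSemigroup (hUR s) t).eq (x : E)
    · ext x
      have h1 := DFunLike.congr_fun h.leftSemigroup_sub_neg (x : E)
      have h2 : leftSemigroup δ (fun w => -R (-w)) 0 (x : E) = 0 := x.2
      rw [sub_apply, h2, sub_zero] at h1
      exact h1
    · intro s t hs ht
      ext x
      have h1 := DFunLike.congr_fun h.leftSemigroup_sub_neg (x : E)
      have h2 : leftSemigroup δ (fun w => -R (-w)) 0 (x : E) = 0 := x.2
      rw [sub_apply, h2, sub_zero] at h1
      have h3 := DFunLike.congr_fun (h.leftSemigroup_mul hs ht) (x : E)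
      simp only [mul_apply_eq_comp] at h3
      rw [h1] at h3
      exact h3
    · intro x
      refine continuousOn_iff_continuous_domRestrict.2 (Continuous.subtype_mk ?_ _)
      exact continuousOn_iff_continuous_domRestrict.1
        (h.continuousOn_leftSemigroup.clm_apply continuousOn_const)
    · intro x t ht
      refine hasDerivAt_subtype ?_
      have h1 := ((ContinuousLinearMap.apply ℂ E (x : E)).restrictScalars ℝ).hasFDerivAt.comp_hasDerivAt
        t (h.hasDerivAt_leftPrimitive t)
      have h2 : HasDerivAt (fun s => leftPrimitive δ R s (x : E)) (-leftSemigroup δ R t x) t := by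
        exact h1
      refine (h2.congr_of_eventuallyEq ?_).congr_deriv (by simp)
      filter_upwards [lt_mem_nhds ht] with s hs
      rw [← h.leftSemigroup_mul_resolvent hs.le]
      rfl
    · obtain ⟨C, hC⟩ := h.exists_norm_le
      refine ⟨|C|, fun t ht => (norm_restrictCLM_le _ _ _).trans ((hC t).1.trans ?_)⟩
      refine (mul_le_mul_of_nonneg_right (le_abs_self C) (Real.exp_pos _).le).trans ?_
      refine mul_le_of_le_one_right (abs_nonneg C) ?_
      rw [Real.exp_le_one_iff, neg_mul, neg_nonpos]
      exact mul_nonneg h.pos.le ht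
  exact hreg.generatesHolomorphic (h.zero.restrict F hRF)

/-- The resolvents on the two spectral subspaces combine to a resolvent on the whole space. -/
theorem mem_resolventSet_of_restrict (h : IsStripResolvent A δ R) {μ : ℂ}
    (h₁ : μ ∈ resolventSet (restrict A (leftSpace δ R)))
    (h₂ : μ ∈ resolventSet (restrict A (leftSpace δ (fun w => -R (-w))))) :
    μ ∈ resolventSet A := by
  obtain ⟨R₁, hR₁⟩ := mem_resolventSet_iff.1 h₁
  obtain ⟨R₂, hR₂⟩ := mem_resolventSet_iff.1 h₂
  set P₁ := (leftSemigroup δ R 0).codRestrict (leftSpace δ R)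
    (h.leftSemigroup_mem le_rfl) with hP₁
  set P₂ := (leftSemigroup δ (fun w => -R (-w)) 0).codRestrict (leftSpace δ (fun w => -R (-w)))
    h.leftSemigroup_neg_mem with hP₂
  have hP : ∀ y : E, (P₁ y : E) - P₂ y = R 0 y := fun y =>
    DFunLike.congr_fun h.leftSemigroup_sub_neg y
  have hP₁R : ∀ y : E, (P₁ (R 0 y) : E) = R 0 (P₁ y) := fun y =>
    DFunLike.congr_fun (h.commute_leftSemigroup_zero 0).eq y
  have hP₂R : ∀ y : E, (P₂ (R 0 y) : E) = R 0 (P₂ y) := fun y => by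
    have hc : Commute (leftSemigroup δ (fun w => -R (-w)) 0) (R 0) := by
      simpa using (h.neg.commute_leftSemigroup_zero 0).neg_right
    exact DFunLike.congr_fun hc.eq y
  -- Formally `S = R(μ) R(0)`, assembled from the two components of `R(0)`. The resolvent identity
  -- then dictates `R(μ) = R(0) - μ S`.
  set S : E →L[ℂ] E := (leftSpace δ R).subtypeL ∘L R₁ ∘L P₁ -
    (leftSpace δ (fun w => -R (-w))).subtypeL ∘L R₂ ∘L P₂ with hS
  have hSapp : ∀ y, S y = R₁ (P₁ y) - (R₂ (P₂ y) : E) := fun y => rfl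
  have hSgraph : ∀ y, (S y, μ • S y - R 0 y) ∈ A.graph := fun y => by
    have g := A.graph.sub_mem (mem_graph_restrict.1 (hR₁.mem_graph (P₁ y)))
      (mem_graph_restrict.1 (hR₂.mem_graph (P₂ y)))
    rw [hSapp, ← hP]
    convert g using 1
    refine Prod.ext rfl ?_
    simp only [Prod.snd_sub, Submodule.coe_sub, Submodule.coe_smul]
    module
  have hTgraph : ∀ y, ((R 0 - μ • S) y, μ • (R 0 - μ • S) y - y) ∈ A.graph := fun y => by
    have h1 := h.zero.mem_graph_iff.1 (hSgraph y)
    rw [h.zero.mem_graph_iff]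
    have h2 : R 0 ((R 0 - μ • S) y) = S y := by
      conv_rhs => rw [h1]
      rw [← map_neg]
      congr 1
      simp
    rw [map_sub, map_smul, h2]
    simp
  -- The components of an eigenvector are eigenvectors of the two restrictions, hence zero, and
  -- their difference is `R 0 d`. Injectivity then upgrades the right inverse to a two-sided one.
  have hinj : ∀ d, (d, μ • d) ∈ A.graph → d = 0 := fun d hd => by
    rw [h.zero.mem_graph_iff, map_smul] at hd
    have e₁ : P₁ d = 0 := by
      have : (P₁ d, μ • P₁ d) ∈ (restrict A (leftSpace δ R)).graph := by
        rw [mem_graph_restrict, h.zero.mem_graph_iff, Submodule.coe_smul, map_smul, ← hP₁R]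
        conv_lhs => rw [hd, map_neg, map_smul]
        rfl
      simpa using (hR₁.left_inv _ _ this).symm
    have e₂ : P₂ d = 0 := by
      have : (P₂ d, μ • P₂ d) ∈ (restrict A (leftSpace δ (fun w => -R (-w)))).graph := by
        rw [mem_graph_restrict, h.zero.mem_graph_iff, Submodule.coe_smul, map_smul, ← hP₂R]
        conv_lhs => rw [hd, map_neg, map_smul]
        rfl
      simpa using (hR₂.left_inv _ _ this).symm
    have := hP d
    rw [e₁, e₂] at this
    refine h.zero.injective ?_
    rw [← this]; simp
  refine mem_resolventSet_iff.2 ⟨R 0 - μ • S, fun x y hxy => ?_, hTgraph⟩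
  rw [← sub_eq_zero]
  refine hinj _ ?_
  have := A.graph.sub_mem (hTgraph (μ • x - y)) hxy
  convert this using 1
  refine Prod.ext rfl ?_
  simp only [Prod.snd_sub]
  module

end IsStripResolvent

end SplittingGroup

/-! ### The splitting theorem. -/

open SplittingGroup in
theorem proposition5p1 {E : Type*} [NormedAddCommGroup E] [NormedSpace ℂ E] [CompleteSpace E]
    (U : ℝ → E →L[ℂ] E) (hU : SplittingGroup.IsC0Group U)
    (A : E →ₗ.[ℂ] E) (hA : SplittingGroup.IsGroupGenerator U (Complex.I • A))
    (δ : ℝ) (hδ : 0 < δ) (σ₁ σ₂ : Set ℂ)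
    (hσ : SplittingGroup.spectrum A = σ₁ ∪ σ₂)
    (hσ₁ : σ₁ ⊆ {z : ℂ | z.re < -δ}) (hσ₂ : σ₂ ⊆ {z : ℂ | δ < z.re}) :
    ∃ E₁ E₂ : Submodule ℂ E,
      IsClosed (E₁ : Set E) ∧ IsClosed (E₂ : Set E) ∧
      (∀ t : ℝ, ∀ x ∈ E₁, U t x ∈ E₁) ∧ (∀ t : ℝ, ∀ x ∈ E₂, U t x ∈ E₂) ∧
      Disjoint E₁ E₂ ∧ A.domain ≤ E₁ ⊔ E₂ ∧
      SplittingGroup.GeneratesHolomorphic (SplittingGroup.restrict A E₁) (Real.pi / 2) ∧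
      SplittingGroup.spectrum (SplittingGroup.restrict A E₁) = σ₁ ∧
      SplittingGroup.GeneratesHolomorphic (-(SplittingGroup.restrict A E₂)) (Real.pi / 2) ∧
      SplittingGroup.spectrum (SplittingGroup.restrict A E₂) = σ₂ := by
  have hstrip : ∀ w : ℂ, |w.re| ≤ δ → w ∈ SplittingGroup.resolventSet A := by
    intro w hw
    by_contra hn
    have hs : w ∈ SplittingGroup.spectrum A := hn
    obtain ⟨h1, h2⟩ := abs_le.1 hw
    rcases hσ ▸ hs with h | h
    · exact absurd (hσ₁ h) (not_lt.2 h1)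
    · exact absurd (hσ₂ h) (not_lt.2 h2)
  obtain ⟨R, h⟩ := exists_isStripResolvent hU hA hδ hstrip
  have hA' := hA.reverse
  rw [neg_smul_comm] at hA'
  obtain ⟨hgen₁, hright⟩ := h.generatesHolomorphic hU hA
  obtain ⟨hgen₂, hleft⟩ := h.neg.generatesHolomorphic hU.reverse hA'
  rw [restrict_neg] at hgen₂ hleft
  have hUR : ∀ s, ∀ w : ℂ, |w.re| ≤ δ → Commute (U s) (R w) := fun s w hw =>
    hA.commute_resolvent hU (h.isResolvent w hw) s
  have hleft' : ∀ μ : ℂ, μ.re < 0 → μ ∈ SplittingGroup.resolventSet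
      (SplittingGroup.restrict A (IsStripResolvent.leftSpace δ fun w => -R (-w))) := fun μ hμ => by
    simpa using neg_mem_resolventSet (hleft (-μ) (by simpa using hμ))
  have hρ₂ : ∀ μ : ℂ, μ ∈ SplittingGroup.resolventSet A → μ ∈ SplittingGroup.resolventSet
      (SplittingGroup.restrict A (IsStripResolvent.leftSpace δ fun w => -R (-w))) := fun μ hμ => by
    have h1 : -μ ∈ SplittingGroup.resolventSet (-A) := by
      refine neg_mem_resolventSet ?_
      rwa [neg_neg]
    have h2 := h.neg.mem_resolventSet_restrict h1
    rw [restrict_neg] at h2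
    simpa using neg_mem_resolventSet h2
  refine ⟨IsStripResolvent.leftSpace δ R, IsStripResolvent.leftSpace δ (fun w => -R (-w)),
    IsStripResolvent.isClosed_leftSpace _ _, IsStripResolvent.isClosed_leftSpace _ _,
    fun t x hx => h.map_leftSpace (hUR t) hx,
    fun t x hx => h.neg.map_leftSpace
      (fun w hw => (hUR t (-w) (by simpa using hw)).neg_right) hx,
    ?_, ?_, hgen₁, ?_, hgen₂, ?_⟩
  · rw [Submodule.disjoint_def]
    intro x hx₁ hx₂
    rw [IsStripResolvent.leftSpace_neg] at hx₂
    have e₁ : leftSemigroup δ (fun w => -R (-w)) 0 x = 0 := hx₁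
    have e₂ : leftSemigroup δ R 0 x = 0 := hx₂
    refine h.zero.injective ?_
    rw [← h.leftSemigroup_sub_neg]
    simp [e₁, e₂]
  · intro x hx
    -- Every `x` in the domain is `-R(0) A x`, and `R(0) = V 0 - V' 0` splits it into vectors of the
    -- two spaces.
    have hg := h.zero.mem_graph_iff.1 (A.mem_graph ⟨x, hx⟩)
    simp only at hg
    rw [hg, ← map_neg, ← h.leftSemigroup_sub_neg, sub_apply]
    exact Submodule.sub_mem _ (Submodule.mem_sup_left (h.leftSemigroup_mem le_rfl _))
      (Submodule.mem_sup_right (h.leftSemigroup_neg_mem _))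
  · refine Subset.antisymm (fun z hz => ?_) fun z hz hz₁ => ?_
    · have hzA : z ∈ σ₁ ∪ σ₂ := hσ ▸ fun hn => hz (h.mem_resolventSet_restrict hn)
      exact hzA.resolve_right fun h2 => hz (hright z (hδ.trans (hσ₂ h2)))
    · have hzA : z ∈ SplittingGroup.spectrum A := hσ ▸ Or.inl hz
      have hre : z.re < -δ := hσ₁ hz
      exact hzA (h.mem_resolventSet_of_restrict hz₁ (hleft' z (by linarith)))
  · refine Subset.antisymm (fun z hz => ?_) fun z hz hz₂ => ?_
    · have hzA : z ∈ σ₁ ∪ σ₂ := hσ ▸ fun hn => hz (hρ₂ z hn)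
      refine hzA.resolve_left fun h1 => hz (hleft' z ?_)
      have hre : z.re < -δ := hσ₁ h1
      linarith
    · have hzA : z ∈ SplittingGroup.spectrum A := hσ ▸ Or.inr hz
      exact hzA (h.mem_resolventSet_of_restrict (hright z (hδ.trans (hσ₂ hz))) hz₂)
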